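/- Let $V$ be a finite set and let $K\colon V^2\to[0,1]$ be a sub-stochastic matrix ($\sum_{y}K(x,y)\le 1$ for all $x\in V$) which is non-degenerate: no non-empty principal sub-matrix of $K$ is stochastic. A \emph{$K$-walk} is the continuous-time walk which, when at $x\in V$, jumps to $y$ at rate $K(x,y)$ and is killed at rate $1-\sum_{y}K(x,y)$. Let $\lambda\in(0,\infty)$, and let $\nu$ be a probability distribution on $V$ such that every site is reachable from $\nu$: for each $x\in V$ there are $m\ge 0$ and $y_0,\dots,y_m=x$ in $V$ with $\nu(y_0)>0$ and $K(y_{i-1},y_i)>0$ for $1\le i\le m$. \emph{Activated random walk dynamics.} Each site is empty, or carries one sleeping particle, or carries $k\ge 1$ active particles. Active particles perform independent $K$-walks (and disappear when killed), and an active particle alone on its site falls asleep at rate $\lambda$; sleeping particles do not move and become active upon contact with another particle. The stable configurations, i.e. those without active particles, form the set $\mathcal X=\{0,\mathrm s\}^V$ and are absorbing. \emph{The $\mathrm{ARW}(K,\lambda,\nu)$ chain} is the discrete-time Markov chain on $\mathcal X$ which, at each step, adds one active particle to the current configuration at a $\nu$-distributed random site (waking up the sleeping particle there, if any), and then runs the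 above dynamics until a stable configuration is reached, which is the new state. Let $P$ be its transition matrix, and define its relaxation time by $$t_{\mathrm{rel}}:=\frac1{1-\rho},\qquad \rho:=\max\{|z|\colon z\in\mathbb C\setminus\{1\}\text{ is an eigenvalue of }P\}.$$ \emph{Theorem.} The maximum $\rho$ exists, $\rho<1$, and $$t_{\mathrm{rel}}=\Bigl(\min_{x\in V}p(x)\Bigr)^{-1},$$ where $p(x)$ is the probability that a $K$-walk with initial distribution $\nu$ visits $x$ (possibly at time $0$) before being killed. -/

import Mathlib

open scoped Topology
open Filter

noncomputable section

/-! ### Finite-state continuous-time Markov chains -/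

/-- The generator of the chain with generator `Q` stopped upon its first visit to `b`. -/
def stoppedGenerator {S : Type*} [DecidableEq S] (Q : Matrix S S ℝ) (b : S) : Matrix S S ℝ :=
  Matrix.of fun i j => if i = b then 0 else Q i j

/-- For the continuous-time Markov chain `(X_t)` with generator `Q` on the finite set `S`, the
probability that `X` ever visits `b` when `X_0 = a`. With `Q'` the generator of the chain stopped at
`b`, the `(a, b)` entry of the transition matrix `exp (t Q')` is the probability that `b` has been
visited by time `t`; then `t → ∞`. -/
def hittingProb {S : Type*} [Fintype S] [DecidableEq S] (Q : Matrix S S ℝ) (a b : S) : ℝ :=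
  limUnder atTop fun t : ℝ => NormedSpace.exp (t • stoppedGenerator Q b) a b

/-! ### The killed walk -/

/-- `K` is a sub-stochastic matrix. -/
def IsSubstochastic {V : Type*} [Fintype V] (K : Matrix V V ℝ) : Prop :=
  (∀ x y, 0 ≤ K x y) ∧ ∀ x, ∑ y, K x y ≤ 1

/-- No (non-empty) principal sub-matrix of `K` is stochastic. -/
def IsNondegenerate {V : Type*} (K : Matrix V V ℝ) : Prop :=
  ∀ A : Finset V, A.Nonempty → ¬ ∀ x ∈ A, ∑ y ∈ A, K x y = 1

/-- The rate at which a `K`-walk sitting at `x` is killed. -/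
def killRate {V : Type*} [Fintype V] (K : Matrix V V ℝ) (x : V) : ℝ := 1 - ∑ y, K x y

/-- `1` if `a = b` and `0` otherwise. -/
def delta {S : Type*} [DecidableEq S] (a b : S) : ℝ := if a = b then 1 else 0

/-- The generator of the `K`-walk on `V` together with a cemetery state `none`: from `x ∈ V`, jump
to `y` at rate `K x y` and to the cemetery at rate `1 - ∑ y, K x y`. A transition from `a` to `a'`
at rate `r` contributes `r * (f a' - f a)` to the generator, hence the differences of deltas. -/
def walkGenerator {V : Type*} [Fintype V] [DecidableEq V] (K : Matrix V V ℝ) :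
    Matrix (Option V) (Option V) ℝ :=
  Matrix.of fun a b => match a with
    | none => 0
    | some x => ∑ y, K x y * (delta (some y) b - delta (some x) b)
        + killRate K x * (delta none b - delta (some x) b)

/-- `p(x)`: the probability that a `K`-walk with initial law `ν` visits `x` before being killed. -/
def visitProb {V : Type*} [Fintype V] [DecidableEq V] (K : Matrix V V ℝ) (ν : V → ℝ) (x : V) : ℝ :=
  ∑ y, ν y * hittingProb (walkGenerator K) (some y) (some x)

/-! ### Configurations -/

/-- State of a site: `active 0` is the empty site, `active k` with `k ≥ 1` is a site carrying `k`
active particles, and `sleeping` is a site carrying a single sleeping particle. -/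
inductive SiteState : Type
  | sleeping : SiteState
  | active (k : ℕ) : SiteState
  deriving DecidableEq

namespace SiteState

/-- Number of active particles. -/
def numActive : SiteState → ℕ
  | sleeping => 0
  | active k => k

/-- Number of particles, active or sleeping. -/
def numParticles : SiteState → ℕ
  | sleeping => 1
  | active k => k

/-- An active particle arrives; it wakes up the sleeping particle, if there is one. -/
def arrive : SiteState → SiteState
  | sleeping => active 2
  | active k => active (k + 1)

/-- An active particle leaves (only used when there is one). -/
def depart : SiteState → SiteState
  | sleeping => sleeping
  | active k => active (k - 1)

theorem numParticles_arrive (s : SiteState) : s.arrive.numParticles = s.numParticles + 1 := by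
  cases s <;> rfl

end SiteState

/-- Configurations with at most `N` particles in total. Particles are never created by the dynamics,
so this set is closed under it. -/
def Config (V : Type*) [Fintype V] (N : ℕ) : Type _ :=
  {η : V → SiteState // ∑ x, (η x).numParticles ≤ N}

instance instFiniteConfig (V : Type*) [Fintype V] (N : ℕ) : Finite (Config V N) := by
  classical
  let φ : Config V N → V → Option (Fin (N + 1)) := fun η x => match η.1 x with
    | SiteState.sleeping => none
    | SiteState.active k => some (Fin.ofNat (N + 1) k)
  refine Finite.of_injective φ fun η ξ h => Subtype.ext (funext fun x => ?_)
  have hb : ∀ ζ : Config V N, (ζ.1 x).numParticles ≤ N := fun ζ =>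
    (Finset.single_le_sum (f := fun y => (ζ.1 y).numParticles) (fun _ _ => Nat.zero_le _)
      (Finset.mem_univ x)).trans ζ.2
  have hx := congrFun h x
  have h1 := hb η
  have h2 := hb ξ
  simp only [φ] at hx
  cases e1 : η.1 x with
  | sleeping => cases e2 : ξ.1 x with
    | sleeping => rfl
    | active l => simp [e1, e2] at hx
  | active k => cases e2 : ξ.1 x with
    | sleeping => simp [e1, e2] at hx
    | active l =>
      simp only [e1, e2, SiteState.numParticles] at h1 h2
      simp only [e1, e2, Option.some.injEq, Fin.ext_iff, Fin.ofNat] at hx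
      rw [Nat.mod_eq_of_lt (by omega), Nat.mod_eq_of_lt (by omega)] at hx
      rw [hx]

instance instFintypeConfig (V : Type*) [Fintype V] (N : ℕ) : Fintype (Config V N) :=
  Fintype.ofFinite _

instance instDecidableEqConfig (V : Type*) [Fintype V] (N : ℕ) : DecidableEq (Config V N) :=
  Classical.decEq _

/-! ### Activated random walks -/

section ARW

variable {V : Type*} [Fintype V] [DecidableEq V]

/-- Insert an active particle at `x`. -/
def insertAt (η : V → SiteState) (x : V) : V → SiteState :=
  Function.update η x (η x).arrive

/-- Remove an active particle from `x`. -/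
def removeAt (η : V → SiteState) (x : V) : V → SiteState :=
  Function.update η x (η x).depart

/-- The lone active particle at `x` falls asleep. -/
def sleepAt (η : V → SiteState) (x : V) : V → SiteState :=
  Function.update η x SiteState.sleeping

/-- The generator of the activated random walk dynamics, as an infinite matrix indexed by all
configurations: each of the active particles at `x` jumps to `y` at rate `K x y` and is killed at
rate `1 - ∑ y, K x y`, and an active particle alone at `x` falls asleep at rate `lam`. -/
def arwRate (K : Matrix V V ℝ) (lam : ℝ) (η ξ : V → SiteState) : ℝ :=
  ∑ x, (((η x).numActive : ℝ) *
      (∑ y, K x y * (delta (insertAt (removeAt η x) y) ξ - delta η ξ)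
        + killRate K x * (delta (removeAt η x) ξ - delta η ξ))
    + if η x = SiteState.active 1 then lam * (delta (sleepAt η x) ξ - delta η ξ) else 0)

/-- The generator of the activated random walk dynamics with at most `N` particles. -/
def arwGenerator (K : Matrix V V ℝ) (lam : ℝ) (N : ℕ) : Matrix (Config V N) (Config V N) ℝ :=
  Matrix.of fun η ξ => arwRate K lam η.1 ξ.1

/-- The stable configuration whose set of sleeping particles is `{x | η x = true}` and whose
other sites are empty. The set `{0, s}^V` of stable configurations is thus encoded as `V → Bool`. -/
def ofStable (η : V → Bool) : V → SiteState :=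
  fun x => if η x then SiteState.sleeping else SiteState.active 0

theorem numParticles_ofStable_le (η : V → Bool) :
    ∑ x, (ofStable η x).numParticles ≤ Fintype.card V + 1 := by
  have h : ∑ x, (ofStable η x).numParticles ≤ ∑ _x : V, 1 :=
    Finset.sum_le_sum fun x _ => by
      unfold ofStable
      split <;> simp [SiteState.numParticles]
  simp at h
  omega

theorem numParticles_insertAt_le (η : V → Bool) (x : V) :
    ∑ y, (insertAt (ofStable η) x y).numParticles ≤ Fintype.card V + 1 := by
  have h : ∑ y, (insertAt (ofStable η) x y).numParticles
      ≤ ∑ y : V, (1 + if y = x then 1 else 0) := by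
    refine Finset.sum_le_sum fun y _ => ?_
    have h1 : ∀ z, (ofStable η z).numParticles ≤ 1 := fun z => by
      unfold ofStable
      split <;> simp [SiteState.numParticles]
    by_cases hy : y = x
    · subst hy
      simp [insertAt, SiteState.numParticles_arrive, h1 y]
    · simp [insertAt, hy, h1 y]
  simpa [Finset.sum_add_distrib] using h

/-- A stable configuration, seen in the state space of the dynamics. -/
def stableConfig (η : V → Bool) : Config V (Fintype.card V + 1) :=
  ⟨ofStable η, numParticles_ofStable_le η⟩

/-- A stable configuration to which one active particle has been added at `x`. -/
def perturbedConfig (η : V → Bool) (x : V) : Config V (Fintype.card V + 1) :=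
  ⟨insertAt (ofStable η) x, numParticles_insertAt_le η x⟩

/-- The transition matrix of the `ARW(K, lam, ν)` chain on stable configurations: from `η`, add an
active particle at a `ν`-distributed site and run the dynamics until a stable configuration is
reached. Stable configurations are absorbing, so the dynamics ends in `ξ` iff it visits `ξ`. -/
def arwMatrix (K : Matrix V V ℝ) (lam : ℝ) (ν : V → ℝ) : Matrix (V → Bool) (V → Bool) ℝ :=
  Matrix.of fun η ξ => ∑ x, ν x *
    hittingProb (arwGenerator K lam (Fintype.card V + 1)) (perturbedConfig η x) (stableConfig ξ)

end ARW

/-- `τ` is the relaxation time `1 / (1 - ρ)` of the transition matrix `P`, where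
`ρ < 1` is the largest modulus of a complex eigenvalue of `P` other than `1`. -/
def IsRelaxationTime {S : Type*} [Fintype S] [DecidableEq S] (P : Matrix S S ℝ) (τ : ℝ) : Prop :=
  ∃ ρ : ℝ, IsGreatest {r : ℝ | ∃ z : ℂ, z ≠ 1 ∧
      Module.End.HasEigenvalue (Matrix.toLin' (P.map Complex.ofReal)) z ∧ r = ‖z‖} ρ ∧
    ρ < 1 ∧ τ = 1 / (1 - ρ)

end

/-!
The idea is to extend functions `f` on stable configurations to all configurations, by taking the
expected value `H f η` of `f` at the stabilisation of `η`. By the abelian property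
(`exists_isSiteHarmonic`), `H f` is harmonic for the toppling of each single active site. It follows
that `η ↦ H f (η + δ_x)` has the same property, so that `H (P f) η = ∑ x, ν x * H f (η + δ_x)` holds
for *all* `η`, not only for the stable ones (`stabExpectation_arwMatrix`).

Now let `η` have at most one particle per site and let `A` be the set of its active sites. A particle
added to `η` performs a `K`-walk as long as it stays in `A`, since it is never alone there. If it is
killed before leaving `A`, then `η` is left; otherwise a site outside `A` becomes active, so that
the number of active sites grows. Ordered by this number, the matrix of `P` is triangular, with the
probabilities that the walk is killed before leaving `A` on the diagonal. For an eigenfunction `f`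
with eigenvalue `z`, take `η` with `H f η ≠ 0` and the most active sites. Then `z` is the
diagonal entry of `A`: it is `1` if `A` is everything, and otherwise it is at most `1 - p(w)` for
each `w ∉ A` (`norm_eigenvalue_le`).

Conversely, if `A` misses only the site `w`, the difference of the functionals `f ↦ H f η` for
`A` active and for all sites active is a left eigenvector with eigenvalue `1 - p(w)`
(`hasEigenvalue_one_sub`). It is not zero: the functionals `f ↦ H f η` for the configurations `η`
without sleeping particles determine `f` (`eq_zero_of_ofActive`), and there are as many of them as the
dimension, so that they are linearly independent.

The hitting probabilities in the definition of the chain and of `p` are limits of exponentials of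
generators. They are identified with harmonic functions by means of a Lyapunov function for
absorption (`hittingProb_eq`).
-/

/-! ### The killed walk: maximum principle and visit probabilities -/

section Walk

variable {V : Type*} [Fintype V]

theorem killRate_nonneg {K : Matrix V V ℝ} (hK : IsSubstochastic K) (x : V) :
    0 ≤ killRate K x := sub_nonneg.2 (hK.2 x)

/-- Maximum principle for the killed walk: the set where a subharmonic function attains a positive
maximum would index a stochastic principal sub-matrix. -/
theorem nonpos_of_subharmonic {K : Matrix V V ℝ} (hK : IsSubstochastic K)
    (hK' : IsNondegenerate K) {D : V → ℝ} (hD : ∀ x, D x ≤ 0 ∨ D x ≤ ∑ y, K x y * D y) (x : V) :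
    D x ≤ 0 := by
  classical
  by_contra! hx
  have : Nonempty V := ⟨x⟩
  obtain ⟨m, hm⟩ := Finite.exists_max D
  have hpos : 0 < D m := hx.trans_le (hm x)
  refine hK' (Finset.univ.filter fun y => D y = D m) ⟨m, by simp⟩ fun a ha => ?_
  have ha' : D a = D m := by simpa using ha
  have h1 : D m ≤ ∑ y, K a y * D y := by
    rcases hD a with h | h
    · linarith
    · linarith
  have h2 : ∀ y, K a y * D y ≤ K a y * D m := fun y =>
    mul_le_mul_of_nonneg_left (hm y) (hK.1 a y)
  have h3 : ∑ y, K a y * D y ≤ ∑ y, K a y * D m := Finset.sum_le_sum fun y _ => h2 y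
  have h4 : ∑ y, K a y * D m = (∑ y, K a y) * D m := by rw [Finset.sum_mul]
  have h5 : (∑ y, K a y) * D m ≤ D m := by nlinarith [hK.2 a]
  have h6 : ∑ y, K a y = 1 := by
    have : (∑ y, K a y) * D m = 1 * D m := by linarith
    exact mul_right_cancel₀ hpos.ne' this
  have h7 : ∀ y, K a y * D y = K a y * D m := by
    have := (Finset.sum_eq_sum_iff_of_le (fun y (_ : y ∈ Finset.univ) => h2 y)).1 (by linarith)
    exact fun y => this y (Finset.mem_univ y)
  rw [← h6]
  refine Finset.sum_subset (Finset.subset_univ _) fun y _ hy => ?_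
  by_contra h0
  exact hy (by simpa using mul_left_cancel₀ h0 (h7 y))

theorem eq_zero_of_harmonic {E : Type*} [NormedAddCommGroup E] [NormedSpace ℝ E]
    {K : Matrix V V ℝ} (hK : IsSubstochastic K) (hK' : IsNondegenerate K) {φ : V → E}
    (hφ : ∀ x, φ x = 0 ∨ φ x = ∑ y, K x y • φ y) (x : V) : φ x = 0 := by
  rw [← norm_le_zero_iff]
  refine nonpos_of_subharmonic (D := fun x => ‖φ x‖) hK hK' (fun x => ?_) x
  rcases hφ x with h | h
  · exact Or.inl (by simp [h])
  · right
    calc ‖φ x‖ = ‖∑ y, K x y • φ y‖ := by rw [← h]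
      _ ≤ ∑ y, ‖K x y • φ y‖ := norm_sum_le _ _
      _ = ∑ y, K x y * ‖φ y‖ := by
        simp only [norm_smul, Real.norm_eq_abs, abs_of_nonneg (hK.1 x _)]

/-- A `K`-walk at `x` can reach a site with positive killing rate in at most `n` jumps. -/
def CanBeKilled (K : Matrix V V ℝ) : ℕ → V → Prop
  | 0, x => 0 < killRate K x
  | n + 1, x => CanBeKilled K n x ∨ ∃ y, 0 < K x y ∧ CanBeKilled K n y

/-- From every site, a site with positive killing rate can be reached; `d` is the number of steps
this takes. -/
theorem exists_rank {K : Matrix V V ℝ} (hK : IsSubstochastic K) (hK' : IsNondegenerate K) :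
    ∃ d : V → ℕ, ∀ x, 0 < killRate K x ∨ ∃ y, 0 < K x y ∧ d y < d x := by
  classical
  have hR : ∀ x, ∃ n, CanBeKilled K n x := by
    by_contra! hcon
    obtain ⟨x₀, hx₀⟩ := hcon
    refine hK' (Finset.univ.filter fun x : V => ∀ n, ¬ CanBeKilled K n x) ⟨x₀, by simpa using hx₀⟩
      fun x hx => ?_
    have hx' : ∀ n, ¬ CanBeKilled K n x := by simpa using hx
    have h0 : killRate K x = 0 := le_antisymm (not_lt.1 (hx' 0)) (killRate_nonneg hK x)
    have h1 : ∑ y, K x y = 1 := by unfold killRate at h0; linarith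
    rw [← h1]
    refine Finset.sum_subset (Finset.subset_univ _) fun y _ hy => ?_
    by_contra hne
    have hpos : 0 < K x y := lt_of_le_of_ne (hK.1 x y) (Ne.symm hne)
    simp only [Finset.mem_filter, Finset.mem_univ, true_and, not_forall, not_not] at hy
    obtain ⟨n, hn⟩ := hy
    exact hx' (n + 1) (Or.inr ⟨y, hpos, hn⟩)
  have hdec : ∀ x : V, DecidablePred fun n => CanBeKilled K n x := fun _ => Classical.decPred _
  refine ⟨fun x => Nat.find (hR x), fun x => ?_⟩
  have hs := Nat.find_spec (hR x)
  rcases hn : Nat.find (hR x) with _ | n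
  · rw [hn] at hs
    exact Or.inl hs
  · rw [hn] at hs
    rcases hs with h | ⟨y, hy, hy'⟩
    · exact absurd (Nat.find_min' (hR x) h) (by omega)
    · refine Or.inr ⟨y, hy, (Nat.lt_succ_of_le (Nat.find_min' (hR y) hy')).trans_eq hn.symm⟩

/-- `v` is the function `y ↦ P_y(the killed walk visits w)`, characterised by the first-step
equations. -/
def IsVisitFunction (K : Matrix V V ℝ) (w : V) (v : V → ℝ) : Prop :=
  v w = 1 ∧ ∀ y, y ≠ w → v y = ∑ z, K y z * v z

theorem exists_isVisitFunction {K : Matrix V V ℝ} (hK : IsSubstochastic K)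
    (hK' : IsNondegenerate K) (w : V) : ∃ v, IsVisitFunction K w v := by
  classical
  let L : (V → ℝ) →ₗ[ℝ] (V → ℝ) :=
    { toFun := fun v y => if y = w then v y else v y - ∑ z, K y z * v z
      map_add' := fun v v' => by
        ext y
        by_cases hy : y = w
        · simp [hy]
        · simp only [hy, if_false, Pi.add_apply, mul_add, Finset.sum_add_distrib]
          ring
      map_smul' := fun c v => by
        ext y
        by_cases hy : y = w
        · simp [hy]
        · simp only [hy, if_false, Pi.smul_apply, smul_eq_mul, RingHom.id_apply, mul_sub,
            Finset.mul_sum]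
          congr 1
          exact Finset.sum_congr rfl fun z _ => by ring }
  have hinj : Function.Injective L := by
    rw [injective_iff_map_eq_zero]
    intro v hv
    ext y
    refine eq_zero_of_harmonic hK hK' (fun x => ?_) y
    have hx := congrFun hv x
    by_cases hxw : x = w
    · exact Or.inl (by simpa [L, hxw] using hx)
    · right
      simp only [L, LinearMap.coe_mk, AddHom.coe_mk, hxw, if_false, Pi.zero_apply] at hx
      simp only [smul_eq_mul]
      linarith
  obtain ⟨v, hv⟩ := (LinearMap.injective_iff_surjective.1 hinj) (Pi.single w 1)
  refine ⟨v, ?_, fun y hy => ?_⟩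
  · simpa [L] using congrFun hv w
  · have := congrFun hv y
    simp only [L, LinearMap.coe_mk, AddHom.coe_mk, hy, if_false, Pi.single_apply] at this
    linarith

namespace IsVisitFunction

variable {K : Matrix V V ℝ} {w : V} {v : V → ℝ}

theorem nonneg (hv : IsVisitFunction K w v) (hK : IsSubstochastic K) (hK' : IsNondegenerate K)
    (y : V) : 0 ≤ v y := by
  have := nonpos_of_subharmonic (D := fun x => - v x) hK hK' (fun x => ?_) y
  · linarith
  · by_cases hx : x = w
    · left; simp [hx, hv.1]
    · right
      simp [hv.2 x hx]

theorem le_one (hv : IsVisitFunction K w v) (hK : IsSubstochastic K) (hK' : IsNondegenerate K)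
    (y : V) : v y ≤ 1 := by
  have := nonpos_of_subharmonic (D := fun x => v x - 1) hK hK' (fun x => ?_) y
  · linarith
  · by_cases hx : x = w
    · left; simp [hx, hv.1]
    · right
      have := hK.2 x
      simp only [mul_sub, mul_one, Finset.sum_sub_distrib, ← hv.2 x hx]
      linarith

theorem pos (hv : IsVisitFunction K w v) (hK : IsSubstochastic K) (hK' : IsNondegenerate K)
    {y : V} (hy : Relation.ReflTransGen (fun a b => 0 < K a b) y w) : 0 < v y := by
  induction hy using Relation.ReflTransGen.head_induction_on with
  | refl => simp [hv.1]
  | @head a b hab _ ih =>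
    by_cases ha : a = w
    · simp [ha, hv.1]
    · rw [hv.2 a ha]
      exact Finset.sum_pos' (fun z _ => mul_nonneg (hK.1 a z) (hv.nonneg hK hK' z))
        ⟨b, Finset.mem_univ b, mul_pos hab ih⟩

/-- First-step equation for the probability `1 - v` of avoiding `w`. -/
theorem one_sub (hv : IsVisitFunction K w v) {y : V} (hy : y ≠ w) :
    1 - v y = ∑ z, K y z * (1 - v z) + killRate K y := by
  simp only [mul_sub, mul_one, Finset.sum_sub_distrib, ← hv.2 y hy, killRate]
  ring

end IsVisitFunction

end Walk

/-! ### Toppling instructions -/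

theorem SiteState.numActive_arrive_pos (s : SiteState) : 0 < s.arrive.numActive := by
  cases s <;> simp [SiteState.arrive, SiteState.numActive]

theorem SiteState.depart_arrive {s : SiteState} (h : 0 < s.numActive) : s.arrive.depart = s := by
  cases s <;> simp_all [SiteState.arrive, SiteState.numActive, SiteState.depart]

theorem SiteState.arrive_depart {s : SiteState} (h : 0 < s.numActive) : s.depart.arrive = s := by
  cases s with
  | sleeping => simp [SiteState.numActive] at h
  | active k =>
    simp only [SiteState.numActive] at h
    simp only [SiteState.arrive, SiteState.depart]
    congr
    omega

theorem SiteState.numParticles_depart {s : SiteState} (h : 0 < s.numActive) :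
    s.depart.numParticles + 1 = s.numParticles := by
  rw [← SiteState.numParticles_arrive, SiteState.arrive_depart h]

theorem SiteState.numActive_depart {s : SiteState} (h : 0 < s.numActive) :
    s.depart.numActive + 1 = s.numActive := by
  cases s with
  | sleeping => simp [SiteState.numActive] at h
  | active k =>
    simp only [SiteState.numActive, SiteState.depart] at h ⊢
    omega

theorem SiteState.numActive_arrive_le (s : SiteState) :
    s.arrive.numActive ≤ s.numActive + 2 := by
  cases s <;> simp [SiteState.arrive, SiteState.numActive]

section Instructions

variable {V : Type*} [Fintype V] [DecidableEq V]

/-- The rates of the instructions that a site `x` can execute: `none` is the instruction to fall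
asleep, `some none` to kill a particle, `some (some u)` to send a particle to `u`. -/
def instrRate (K : Matrix V V ℝ) (lam : ℝ) (x : V) : Option (Option V) → ℝ
  | none => lam
  | some none => killRate K x
  | some (some u) => K x u

/-- The configuration after the active site `x` has executed an instruction. The instruction to fall
asleep has no effect when there are at least two particles at `x`. -/
def instrAct (x : V) : Option (Option V) → (V → SiteState) → V → SiteState
  | none, η => if η x = SiteState.active 1 then sleepAt η x else η
  | some none, η => removeAt η x
  | some (some u), η => insertAt (removeAt η x) u

/-- The generator of the dynamics in which the only event is that site `x` executes each
instruction at its rate, irrespective of the number of particles at `x`. -/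
def topple (K : Matrix V V ℝ) (lam : ℝ) {E : Type*} [AddCommGroup E] [Module ℝ E] (x : V)
    (ψ : (V → SiteState) → E) (η : V → SiteState) : E :=
  ∑ i, instrRate K lam x i • (ψ (instrAct x i η) - ψ η)

theorem topple_eq (K : Matrix V V ℝ) (lam : ℝ) {E : Type*} [AddCommGroup E] [Module ℝ E] (x : V)
    (ψ : (V → SiteState) → E) (η : V → SiteState) :
    topple K lam x ψ η = lam • (ψ (instrAct x none η) - ψ η)
      + (killRate K x • (ψ (removeAt η x) - ψ η)
        + ∑ u, K x u • (ψ (insertAt (removeAt η x) u) - ψ η)) := by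
  simp only [topple, Fintype.sum_option, instrRate, instrAct]

omit [DecidableEq V] in
theorem instrRate_nonneg {K : Matrix V V ℝ} (hK : IsSubstochastic K) {lam : ℝ} (hlam : 0 ≤ lam)
    (x : V) (i : Option (Option V)) : 0 ≤ instrRate K lam x i := by
  rcases i with _ | _ | u
  · exact hlam
  · exact killRate_nonneg hK x
  · exact hK.1 x u

omit [Fintype V] in
theorem insertAt_comm (η : V → SiteState) (x y : V) :
    insertAt (insertAt η x) y = insertAt (insertAt η y) x := by
  by_cases h : x = y
  · rw [h]
  · simp only [insertAt, Function.update_of_ne (Ne.symm h), Function.update_of_ne h]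
    exact Function.update_comm h _ _ _

omit [Fintype V] in
theorem removeAt_insertAt_self {η : V → SiteState} {x : V} (h : 0 < (η x).numActive) :
    removeAt (insertAt η x) x = η := by
  simp [removeAt, insertAt, SiteState.depart_arrive h]

omit [Fintype V] in
theorem insertAt_removeAt_self {η : V → SiteState} {x : V} (h : 0 < (η x).numActive) :
    insertAt (removeAt η x) x = η := by
  simp [removeAt, insertAt, SiteState.arrive_depart h]

omit [Fintype V] in
theorem removeAt_insertAt {η : V → SiteState} {y : V} (h : 0 < (η y).numActive) (x : V) :
    removeAt (insertAt η x) y = insertAt (removeAt η y) x := by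
  by_cases hxy : x = y
  · subst hxy
    rw [removeAt_insertAt_self h, insertAt_removeAt_self h]
  · simp only [removeAt, insertAt, Function.update_of_ne hxy,
      Function.update_of_ne (Ne.symm hxy)]
    exact Function.update_comm hxy _ _ _

omit [Fintype V] in
theorem numActive_insertAt_self (η : V → SiteState) (x : V) :
    0 < (insertAt η x x).numActive := by
  simp [insertAt, SiteState.numActive_arrive_pos]

omit [Fintype V] in
theorem numActive_insertAt {η : V → SiteState} {y : V} (h : 0 < (η y).numActive) (x : V) :
    0 < (insertAt η x y).numActive := by
  by_cases hxy : y = x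
  · subst hxy; exact numActive_insertAt_self η y
  · simpa [insertAt, hxy] using h

omit [Fintype V] in
/-- Executing an instruction at an active site commutes with adding a particle anywhere. In
particular, a particle that has just fallen asleep at `x` is woken up by one arriving at `x`, whereas
in the other order the instruction has no effect. -/
theorem instrAct_insertAt {η : V → SiteState} {y : V} (h : 0 < (η y).numActive) (x : V)
    (i : Option (Option V)) : instrAct y i (insertAt η x) = insertAt (instrAct y i η) x := by
  have hrem := removeAt_insertAt h x
  rcases i with _ | _ | u
  · by_cases hxy : x = y
    · subst hxy
      obtain ⟨k, hk⟩ : ∃ k, η x = SiteState.active (k + 1) := by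
        cases e : η x with
        | sleeping => simp [e, SiteState.numActive] at h
        | active k => exact ⟨k - 1, by simp [e, SiteState.numActive] at h; congr; omega⟩
      rcases k with _ | k
      · simp [instrAct, insertAt, sleepAt, hk, SiteState.arrive]
      · simp [instrAct, insertAt, hk, SiteState.arrive]
    · simp only [instrAct, insertAt, sleepAt, Function.update_of_ne (Ne.symm hxy)]
      split_ifs
      · rw [Function.update_of_ne hxy, Function.update_comm hxy]
      · rfl
  · exact hrem
  · simp only [instrAct, hrem]
    exact insertAt_comm _ _ _

omit [Fintype V] in
theorem numActive_instrAct {η : V → SiteState} {y z : V} (hyz : y ≠ z)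
    (h : 0 < (η y).numActive) (i : Option (Option V)) : 0 < (instrAct z i η y).numActive := by
  have hrem : 0 < (removeAt η z y).numActive := by simpa [removeAt, hyz] using h
  rcases i with _ | _ | u
  · simp only [instrAct]
    split_ifs
    · simpa [sleepAt, hyz] using h
    · exact h
  · exact hrem
  · exact numActive_insertAt hrem u

omit [Fintype V] in
/-- Local abelian property: instructions at two distinct active sites commute. -/
theorem instrAct_comm {η : V → SiteState} {y z : V} (hyz : y ≠ z) (hy : 0 < (η y).numActive)
    (hz : 0 < (η z).numActive) (i j : Option (Option V)) :
    instrAct y i (instrAct z j η) = instrAct z j (instrAct y i η) := by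
  -- a jump is the removal of a particle followed by an insertion, and insertions commute with
  -- everything
  have base : ∀ i j : Option (Option V), (i = none ∨ i = some none) → (j = none ∨ j = some none) →
      instrAct y i (instrAct z j η) = instrAct z j (instrAct y i η) := by
    rintro i j (rfl | rfl) (rfl | rfl) <;>
      simp only [instrAct, sleepAt, removeAt] <;> (try split_ifs) <;>
      simp_all [Function.update_of_ne hyz.symm,
        Function.update_comm hyz]
  have step : ∀ i j : Option (Option V), (i = none ∨ i = some none) →
      instrAct y i (instrAct z j η) = instrAct z j (instrAct y i η) := by
    rintro i (_ | _ | w) hi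
    · exact base i _ hi (Or.inl rfl)
    · exact base i _ hi (Or.inr rfl)
    · calc instrAct y i (insertAt (instrAct z (some none) η) w)
          = insertAt (instrAct y i (instrAct z (some none) η)) w :=
            instrAct_insertAt (numActive_instrAct hyz hy _) _ _
        _ = _ := by rw [base i _ hi (Or.inr rfl)]; rfl
  rcases i with _ | _ | u
  · exact step _ j (Or.inl rfl)
  · exact step _ j (Or.inr rfl)
  · calc insertAt (instrAct y (some none) (instrAct z j η)) u
        = insertAt (instrAct z j (instrAct y (some none) η)) u := by rw [step _ j (Or.inr rfl)]
      _ = _ := (instrAct_insertAt (numActive_instrAct hyz.symm hz _) _ _).symm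

theorem topple_comm (K : Matrix V V ℝ) (lam : ℝ) {E : Type*} [AddCommGroup E] [Module ℝ E]
    (ψ : (V → SiteState) → E) {η : V → SiteState} {y z : V} (hyz : y ≠ z)
    (hy : 0 < (η y).numActive) (hz : 0 < (η z).numActive) :
    topple K lam y (topple K lam z ψ) η = topple K lam z (topple K lam y ψ) η := by
  simp only [topple, ← Finset.sum_sub_distrib, Finset.smul_sum]
  rw [Finset.sum_comm]
  refine Finset.sum_congr rfl fun j _ => Finset.sum_congr rfl fun i _ => ?_
  rw [instrAct_comm hyz hy hz]
  module

/-! ### Termination -/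

/-- A quantity that decreases by moving a particle along a path on which `d` decreases, even if it
wakes up another one on its way. -/
def energy (d : V → ℕ) (η : V → SiteState) : ℕ :=
  ∑ x, (2 * d x * (η x).numParticles + (η x).numActive)

theorem sum_update_add (F : V → SiteState → ℕ) (η : V → SiteState) (x : V)
    (s : SiteState) :
    ∑ y, F y (Function.update η x s y) + F x (η x) = ∑ y, F y (η y) + F x s := by
  rw [← Finset.add_sum_erase _ _ (Finset.mem_univ x),
    ← Finset.add_sum_erase Finset.univ (fun y => F y (η y)) (Finset.mem_univ x)]
  have : ∑ y ∈ Finset.univ.erase x, F y (Function.update η x s y)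
      = ∑ y ∈ Finset.univ.erase x, F y (η y) :=
    Finset.sum_congr rfl fun y hy => by rw [Function.update_of_ne (Finset.ne_of_mem_erase hy)]
  rw [this, Function.update_self]
  omega

theorem energy_removeAt (d : V → ℕ) {η : V → SiteState} {x : V} (h : 0 < (η x).numActive) :
    energy d (removeAt η x) + 2 * d x + 1 = energy d η := by
  have := sum_update_add (fun y s => 2 * d y * s.numParticles + s.numActive) η x (η x).depart
  have h1 := SiteState.numParticles_depart h
  have h2 := SiteState.numActive_depart h
  simp only [energy, removeAt]
  nlinarith

theorem energy_insertAt_le (d : V → ℕ) (η : V → SiteState) (x : V) :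
    energy d (insertAt η x) ≤ energy d η + 2 * d x + 2 := by
  have := sum_update_add (fun y s => 2 * d y * s.numParticles + s.numActive) η x (η x).arrive
  have h1 := SiteState.numParticles_arrive (η x)
  have h2 := SiteState.numActive_arrive_le (η x)
  simp only [energy, insertAt]
  nlinarith

theorem sum_numParticles_insertAt (η : V → SiteState) (x : V) :
    ∑ y, (insertAt η x y).numParticles = ∑ y, (η y).numParticles + 1 := by
  have := sum_update_add (fun _ s => s.numParticles) η x (η x).arrive
  simp only [SiteState.numParticles_arrive] at this
  simp only [insertAt]
  omega

theorem sum_numParticles_removeAt {η : V → SiteState} {x : V} (h : 0 < (η x).numActive) :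
    ∑ y, (removeAt η x y).numParticles + 1 = ∑ y, (η y).numParticles := by
  rw [← sum_numParticles_insertAt (removeAt η x) x, insertAt_removeAt_self h]

theorem sum_numParticles_instrAct_le {η : V → SiteState} {x : V} (h : 0 < (η x).numActive)
    (i : Option (Option V)) :
    ∑ y, (instrAct x i η y).numParticles ≤ ∑ y, (η y).numParticles := by
  have hrem := sum_numParticles_removeAt h
  rcases i with _ | _ | u
  · simp only [instrAct]
    split_ifs with h1
    · have := sum_update_add (fun _ s => s.numParticles) η x SiteState.sleeping
      simp only [h1, SiteState.numParticles] at this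
      simp only [sleepAt, SiteState.numParticles]
      omega
    · exact le_rfl
  · simp only [instrAct]; omega
  · simp only [instrAct, sum_numParticles_insertAt]; omega

/-- `d` decreases along some possible jump from each site where no particle can be killed. -/
def IsRank (K : Matrix V V ℝ) (d : V → ℕ) : Prop :=
  ∀ x, 0 < killRate K x ∨ ∃ y, 0 < K x y ∧ d y < d x

theorem IsRank.exists_energy_lt {K : Matrix V V ℝ} {d : V → ℕ} (hd : IsRank K d) (lam : ℝ)
    {η : V → SiteState} {x : V} (h : 0 < (η x).numActive) :
    ∃ i, 0 < instrRate K lam x i ∧ energy d (instrAct x i η) < energy d η := by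
  have h1 := energy_removeAt d h
  rcases hd x with hk | ⟨y, hy, hlt⟩
  · exact ⟨some none, hk, by simp only [instrAct]; omega⟩
  · have h2 := energy_insertAt_le d (removeAt η x) y
    exact ⟨some (some y), hy, by simp only [instrAct]; omega⟩

/-- Maximum principle for activated random walks, where one is free to choose which active site is
toppled. -/
theorem nonpos_of_topple_nonneg {K : Matrix V V ℝ} (hK : IsSubstochastic K)
    (hK' : IsNondegenerate K) {lam : ℝ} (hlam : 0 ≤ lam) {ψ : (V → SiteState) → ℝ}
    (hψ : ∀ η, ψ η ≤ 0 ∨ ∃ z, 0 < (η z).numActive ∧ 0 ≤ topple K lam z ψ η)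
    (η : V → SiteState) : ψ η ≤ 0 := by
  obtain ⟨d, hd⟩ : ∃ d, IsRank K d := exists_rank hK hK'
  by_contra! hη
  set N := ∑ x, (η x).numParticles with hN
  have : Nonempty (Config V N) := ⟨⟨η, le_rfl⟩⟩
  obtain ⟨m, hm⟩ := Finite.exists_max fun c : Config V N => ψ c.1
  have hpos : 0 < ψ m.1 := hη.trans_le (hm ⟨η, le_rfl⟩)
  -- among the maximisers there would be none of least energy
  have key : ∀ n, ∀ c : Config V N, energy d c.1 = n → ψ c.1 ≠ ψ m.1 := by
    intro n
    induction n using Nat.strong_induction_on with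
    | _ n ih =>
      intro c hcn hc
      rcases hψ c.1 with h | ⟨z, hz, h⟩
      · linarith
      have hle : ∀ i, instrRate K lam z i • (ψ (instrAct z i c.1) - ψ c.1) ≤ 0 := fun i =>
        mul_nonpos_of_nonneg_of_nonpos (instrRate_nonneg hK hlam z i) (by
          have := hm ⟨instrAct z i c.1, (sum_numParticles_instrAct_le hz i).trans c.2⟩
          dsimp only at this
          linarith)
      have hzero := (Finset.sum_eq_zero_iff_of_nonpos fun i _ => hle i).1
        (le_antisymm (Finset.sum_nonpos fun i _ => hle i) h)
      obtain ⟨i, hi, hlt⟩ := hd.exists_energy_lt lam hz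
      have h0 := hzero i (Finset.mem_univ i)
      rw [smul_eq_mul, mul_eq_zero, or_iff_right hi.ne', sub_eq_zero] at h0
      exact ih _ (hcn ▸ hlt) ⟨_, (sum_numParticles_instrAct_le hz i).trans c.2⟩ rfl (h0.trans hc)
  exact key _ m rfl rfl

theorem eq_zero_of_topple_eq_zero {K : Matrix V V ℝ} (hK : IsSubstochastic K)
    (hK' : IsNondegenerate K) {lam : ℝ} (hlam : 0 ≤ lam) {E : Type*} [NormedAddCommGroup E]
    [NormedSpace ℝ E] {ψ : (V → SiteState) → E}
    (hψ : ∀ η, ψ η = 0 ∨ ∃ z, 0 < (η z).numActive ∧ topple K lam z ψ η = 0)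
    (η : V → SiteState) : ψ η = 0 := by
  rw [← norm_le_zero_iff]
  refine nonpos_of_topple_nonneg (ψ := fun η => ‖ψ η‖) hK hK' hlam (fun η => ?_) η
  rcases hψ η with h | ⟨z, hz, h⟩
  · exact Or.inl (by simp [h])
  · refine Or.inr ⟨z, hz, ?_⟩
    have hr := instrRate_nonneg hK hlam z
    simp only [topple, smul_sub, Finset.sum_sub_distrib, sub_eq_zero, ← Finset.sum_smul] at h ⊢
    rw [sub_nonneg]
    calc (∑ i, instrRate K lam z i) • ‖ψ η‖ = ‖(∑ i, instrRate K lam z i) • ψ η‖ := by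
          rw [norm_smul, Real.norm_of_nonneg (Finset.sum_nonneg fun i _ => hr i), smul_eq_mul]
      _ = ‖∑ i, instrRate K lam z i • ψ (instrAct z i η)‖ := by rw [h]
      _ ≤ ∑ i, ‖instrRate K lam z i • ψ (instrAct z i η)‖ := norm_sum_le _ _
      _ = ∑ i, instrRate K lam z i • ‖ψ (instrAct z i η)‖ := by
        simp only [norm_smul, Real.norm_of_nonneg (hr _), smul_eq_mul]

end Instructions

/-! ### Stabilisation probabilities and the abelian property -/

section Stabilisation

variable {V : Type*} [Fintype V] [DecidableEq V]

/-- `ψ` is harmonic for the toppling of each active site. -/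
def IsSiteHarmonic (K : Matrix V V ℝ) (lam : ℝ) {E : Type*} [AddCommGroup E] [Module ℝ E]
    (ψ : (V → SiteState) → E) : Prop :=
  ∀ η z, 0 < (η z).numActive → topple K lam z ψ η = 0

omit [Fintype V] [DecidableEq V] in
theorem numActive_ofStable (ξ : V → Bool) (x : V) : (ofStable ξ x).numActive = 0 := by
  unfold ofStable
  split_ifs <;> rfl

omit [Fintype V] [DecidableEq V] in
theorem exists_ofStable_eq {η : V → SiteState} (h : ∀ x, ¬ 0 < (η x).numActive) :
    ∃ ξ, ofStable ξ = η := by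
  classical
  refine ⟨fun x => decide (η x = SiteState.sleeping), funext fun x => ?_⟩
  have hx := h x
  cases e : η x with
  | sleeping => simp [ofStable, e]
  | active k =>
    have : k = 0 := by simpa [e, SiteState.numActive] using hx
    simp [ofStable, e, this]

omit [Fintype V] [DecidableEq V] in
theorem ofStable_injective : Function.Injective (ofStable : (V → Bool) → V → SiteState) := by
  intro ξ ξ' h
  funext x
  have := congrFun h x
  simp only [ofStable] at this
  cases hx : ξ x <;> cases hx' : ξ' x <;> simp_all

theorem eq_zero_of_isSiteHarmonic {K : Matrix V V ℝ} (hK : IsSubstochastic K)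
    (hK' : IsNondegenerate K) {lam : ℝ} (hlam : 0 ≤ lam) {E : Type*} [NormedAddCommGroup E]
    [NormedSpace ℝ E] {ψ : (V → SiteState) → E} (hψ : IsSiteHarmonic K lam ψ)
    (h0 : ∀ ξ, ψ (ofStable ξ) = 0) (η : V → SiteState) : ψ η = 0 := by
  refine eq_zero_of_topple_eq_zero hK hK' hlam (fun ζ => ?_) η
  by_cases h : ∃ z, 0 < (ζ z).numActive
  · obtain ⟨z, hz⟩ := h
    exact Or.inr ⟨z, hz, hψ ζ z hz⟩
  · obtain ⟨ξ, rfl⟩ := exists_ofStable_eq (not_exists.1 h)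
    exact Or.inl (h0 ξ)

omit [DecidableEq V] in
theorem sum_instrRate (K : Matrix V V ℝ) (lam : ℝ) (x : V) :
    ∑ i, instrRate K lam x i = 1 + lam := by
  simp only [Fintype.sum_option, instrRate, killRate]
  ring

/-- For each rule `σ` choosing an active site to topple, there is a function that is harmonic for
the corresponding dynamics: the least fixed point of its transition operator. -/
theorem exists_harmonic_of_rule {K : Matrix V V ℝ} (hK : IsSubstochastic K) {lam : ℝ}
    (hlam : 0 ≤ lam) (σ : (V → SiteState) → V) (ξ : V → Bool) :
    ∃ h : (V → SiteState) → ℝ, h (ofStable ξ) = 1 ∧ (∀ ξ', ξ' ≠ ξ → h (ofStable ξ') = 0) ∧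
      ∀ η, (∃ z, 0 < (η z).numActive) → topple K lam (σ η) h η = 0 := by
  classical
  have hlam1 : (0 : ℝ) < 1 + lam := by linarith
  have hr := instrRate_nonneg hK hlam
  let avg : ((V → SiteState) → Set.Icc (0 : ℝ) 1) → (V → SiteState) → Set.Icc (0 : ℝ) 1 :=
    fun h η => ⟨(∑ i, instrRate K lam (σ η) i * (h (instrAct (σ η) i η) : ℝ)) / (1 + lam), by
      constructor
      · exact div_nonneg (Finset.sum_nonneg fun i _ => mul_nonneg (hr _ i) (h _).2.1) hlam1.le
      · rw [div_le_one hlam1, ← sum_instrRate K lam (σ η)]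
        exact Finset.sum_le_sum fun i _ => mul_le_of_le_one_right (hr _ i) (h _).2.2⟩
  let T : ((V → SiteState) → Set.Icc (0 : ℝ) 1) →o ((V → SiteState) → Set.Icc (0 : ℝ) 1) :=
    { toFun := fun h η => if ∃ z, 0 < (η z).numActive then avg h η
        else if η = ofStable ξ then 1 else 0
      monotone' := fun h h' hh η => by
        dsimp only
        split_ifs
        · refine Subtype.mk_le_mk.2 (div_le_div_of_nonneg_right ?_ hlam1.le)
          exact Finset.sum_le_sum fun i _ => mul_le_mul_of_nonneg_left (hh _) (hr _ i)
        · exact le_rfl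
        · exact le_rfl }
  have hfix : ∀ η, T.lfp η = if ∃ z, 0 < (η z).numActive then avg T.lfp η
      else if η = ofStable ξ then 1 else 0 := fun η => (congrFun T.map_lfp η).symm
  have hst : ∀ ξ' : V → Bool, ¬ ∃ z, 0 < (ofStable ξ' z).numActive := by
    simp [numActive_ofStable]
  refine ⟨fun η => T.lfp η, ?_, fun ξ' hξ' => ?_, fun η hη => ?_⟩
  · dsimp only
    rw [hfix, if_neg (hst ξ), if_pos rfl, Set.Icc.coe_one]
  · dsimp only
    rw [hfix, if_neg (hst ξ'), if_neg (ofStable_injective.ne hξ'), Set.Icc.coe_zero]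
  · have h1 : (T.lfp η : ℝ)
        = (∑ i, instrRate K lam (σ η) i * (T.lfp (instrAct (σ η) i η) : ℝ)) / (1 + lam) := by
      conv_lhs => rw [hfix, if_pos hη]
    rw [eq_div_iff hlam1.ne'] at h1
    simp only [topple, smul_eq_mul, mul_sub, Finset.sum_sub_distrib, ← Finset.sum_mul,
      sum_instrRate]
    linarith

/-- Abelian property: the function that gives the probability to stabilise in `ξ`, when the first
active site in some fixed order is always toppled, is harmonic for the toppling of each active
site. -/
theorem exists_isSiteHarmonic {K : Matrix V V ℝ} (hK : IsSubstochastic K)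
    (hK' : IsNondegenerate K) {lam : ℝ} (hlam : 0 ≤ lam) (ξ : V → Bool) :
    ∃ h : (V → SiteState) → ℝ, h (ofStable ξ) = 1 ∧ (∀ ξ', ξ' ≠ ξ → h (ofStable ξ') = 0) ∧
      IsSiteHarmonic K lam h := by
  classical
  rcases isEmpty_or_nonempty V with hV | ⟨⟨x₀⟩⟩
  · obtain ⟨h, h1, h2, -⟩ : ∃ h : (V → SiteState) → ℝ, h (ofStable ξ) = 1 ∧
        (∀ ξ', ξ' ≠ ξ → h (ofStable ξ') = 0) ∧ True :=
      ⟨fun _ => 1, rfl, fun ξ' h => absurd (Subsingleton.elim _ _) h, trivial⟩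
    exact ⟨h, h1, h2, fun η z => hV.elim z⟩
  let e := Fintype.equivFin V
  have hex : ∀ η : V → SiteState, ∃ z₀, (∃ z, 0 < (η z).numActive) →
      0 < (η z₀).numActive ∧ ∀ y, 0 < (η y).numActive → e z₀ ≤ e y := by
    intro η
    by_cases hη : ∃ z, 0 < (η z).numActive
    · obtain ⟨z, hz⟩ := hη
      obtain ⟨m, hm, hmin⟩ := Finset.exists_min_image
        (Finset.univ.filter fun z => 0 < (η z).numActive) e ⟨z, by simpa using hz⟩
      exact ⟨m, fun _ => ⟨by simpa using hm, fun y hy => hmin y (by simpa using hy)⟩⟩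
    · exact ⟨x₀, fun h => absurd h hη⟩
  choose σ hσ using hex
  obtain ⟨h, h1, h2, h3⟩ := exists_harmonic_of_rule hK hlam σ ξ
  refine ⟨h, h1, h2, ?_⟩
  have key : ∀ n : ℕ, ∀ y, (e y : ℕ) = n → ∀ η, 0 < (η y).numActive → topple K lam y h η = 0 := by
    intro n
    induction n using Nat.strong_induction_on with
    | _ n ih =>
      intro y hy
      -- where `y` is not the first active site `z`, its toppling commutes with that of `z`, so that
      -- `topple y h` is harmonic for the toppling of `z`
      have hD := eq_zero_of_topple_eq_zero hK hK' hlam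
        (ψ := fun η => if 0 < (η y).numActive then topple K lam y h η else 0) (fun η => ?_)
      · intro η hη
        simpa [hη] using hD η
      by_cases hη : 0 < (η y).numActive
      swap
      · exact Or.inl (by simp [hη])
      obtain ⟨hz, hmin⟩ := hσ η ⟨y, hη⟩
      by_cases hzy : σ η = y
      · left
        have := h3 η ⟨y, hη⟩
        rw [hzy] at this
        simp [this]
      · right
        refine ⟨σ η, hz, ?_⟩
        have hlt : (e (σ η) : ℕ) < n := hy ▸ lt_of_le_of_ne (hmin y hη) fun h =>
          hzy (e.injective (Fin.ext h))
        have hzero := ih _ hlt (σ η) rfl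
        have hact : ∀ i, 0 < (instrAct (σ η) i η y).numActive :=
          numActive_instrAct (Ne.symm hzy) hη
        calc topple K lam (σ η) (fun η => if 0 < (η y).numActive then topple K lam y h η else 0) η
            = topple K lam (σ η) (topple K lam y h) η := by simp [topple, hact, hη]
          _ = topple K lam y (topple K lam (σ η) h) η :=
            (topple_comm K lam h (Ne.symm hzy) hη hz).symm
          _ = 0 := Finset.sum_eq_zero fun i _ => by
            rw [hzero η hz, hzero _ (numActive_instrAct hzy hz i), sub_zero, smul_zero]
  exact fun η z hz => key _ z rfl η hz

/-- Adding a particle before or after stabilising makes no difference. -/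
theorem IsSiteHarmonic.comp_insertAt {K : Matrix V V ℝ} {lam : ℝ} {E : Type*} [AddCommGroup E]
    [Module ℝ E] {ψ : (V → SiteState) → E} (hψ : IsSiteHarmonic K lam ψ) (x : V) :
    IsSiteHarmonic K lam fun η => ψ (insertAt η x) := by
  intro η z hz
  rw [← hψ (insertAt η x) z (numActive_insertAt hz x)]
  simp only [topple, instrAct_insertAt hz]

theorem IsSiteHarmonic.sum {K : Matrix V V ℝ} {lam : ℝ} {E : Type*} [AddCommGroup E]
    [Module ℝ E] {ι : Type*} (s : Finset ι) {ψ : ι → (V → SiteState) → E}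
    (hψ : ∀ j ∈ s, IsSiteHarmonic K lam (ψ j)) :
    IsSiteHarmonic K lam fun η => ∑ j ∈ s, ψ j η := by
  intro η z hz
  simp only [topple, ← Finset.sum_sub_distrib, Finset.smul_sum]
  rw [Finset.sum_comm]
  exact Finset.sum_eq_zero fun j hj => hψ j hj η z hz

end Stabilisation

/-! ### Hitting probabilities of finite-state continuous-time chains -/

section Hitting

variable {S : Type*} [Fintype S] [DecidableEq S]

open NormedSpace in
theorem hasDerivAt_exp_smul_apply (Q : Matrix S S ℝ) (a b : S) (t : ℝ) :
    HasDerivAt (fun t : ℝ => exp (t • Q) a b) ((exp (t • Q) * Q) a b) t := by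
  let _ : NormedRing (Matrix S S ℝ) := Matrix.linftyOpNormedRing
  let _ : NormedAlgebra ℝ (Matrix S S ℝ) := Matrix.linftyOpNormedAlgebra
  have h : HasDerivAt (fun u : ℝ => exp (u • Q)) (exp (t • Q) * Q) t :=
    hasDerivAt_exp_smul_const Q t
  exact (hasDerivAt_pi.1 ((hasDerivAt_pi.1 h) a)) b

open NormedSpace in
theorem exp_nonneg_of_nonneg {M : Matrix S S ℝ} (hM : ∀ i j, 0 ≤ M i j) (i j : S) :
    0 ≤ exp M i j := by
  let _ : NormedRing (Matrix S S ℝ) := Matrix.linftyOpNormedRing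
  let _ : NormedAlgebra ℝ (Matrix S S ℝ) := Matrix.linftyOpNormedAlgebra
  have hpow : ∀ (n : ℕ) i j, 0 ≤ (M ^ n) i j := by
    intro n
    induction n with
    | zero =>
      intro i j
      rw [pow_zero, Matrix.one_apply]
      split_ifs <;> norm_num
    | succ n ih =>
      intro i j
      rw [pow_succ, Matrix.mul_apply]
      exact Finset.sum_nonneg fun k _ => mul_nonneg (ih i k) (hM k j)
  have h : HasSum (fun n : ℕ => (n.factorial⁻¹ : ℝ) • M ^ n) (exp M) := exp_series_hasSum_exp' M
  have h' := Pi.hasSum.1 (Pi.hasSum.1 h i) j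
  exact h'.nonneg fun n => mul_nonneg (by positivity) (hpow n i j)

open NormedSpace in
/-- The transition probabilities of a chain are nonnegative: shift the generator by a multiple of
the identity to make its entries nonnegative. -/
theorem exp_smul_nonneg {Q : Matrix S S ℝ} (hoff : ∀ i j, i ≠ j → 0 ≤ Q i j) {t : ℝ} (ht : 0 ≤ t)
    (i j : S) : 0 ≤ exp (t • Q) i j := by
  let _ : NormedRing (Matrix S S ℝ) := Matrix.linftyOpNormedRing
  let _ : NormedAlgebra ℝ (Matrix S S ℝ) := Matrix.linftyOpNormedAlgebra
  set c : ℝ := ∑ k, |Q k k|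
  have hc : ∀ k, 0 ≤ Q k k + c := fun k => by
    have : |Q k k| ≤ c := Finset.single_le_sum (f := fun k => |Q k k|)
      (fun _ _ => abs_nonneg _) (Finset.mem_univ k)
    linarith [neg_abs_le (Q k k)]
  have hM : ∀ i j, 0 ≤ (t • Q + (t * c) • (1 : Matrix S S ℝ)) i j := fun i j => by
    by_cases hij : i = j
    · subst hij
      simp only [Matrix.add_apply, Matrix.smul_apply, Matrix.one_apply_eq, smul_eq_mul]
      nlinarith [mul_nonneg ht (hc i)]
    · simpa [hij] using mul_nonneg ht (hoff i j hij)
  have hcomm : Commute (t • Q + (t * c) • (1 : Matrix S S ℝ)) ((-(t * c)) • (1 : Matrix S S ℝ)) :=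
    (Commute.one_right _).smul_right _
  have hexp : exp (t • Q) = exp (t • Q + (t * c) • (1 : Matrix S S ℝ))
      * exp ((-(t * c)) • (1 : Matrix S S ℝ)) := by
    rw [← Matrix.exp_add_of_commute _ _ hcomm, add_assoc, ← add_smul]
    simp
  have hone : exp ((-(t * c)) • (1 : Matrix S S ℝ))
      = Real.exp (-(t * c)) • (1 : Matrix S S ℝ) := by
    rw [Matrix.smul_one_eq_diagonal, Matrix.exp_diagonal, Matrix.smul_one_eq_diagonal]
    congr 1
    ext k
    rw [Pi.exp_def]
    simp [Real.exp_eq_exp_ℝ]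
  rw [hexp, hone, Matrix.mul_smul, mul_one]
  exact mul_nonneg (Real.exp_pos _).le (exp_nonneg_of_nonneg hM i j)

omit [DecidableEq S] in
theorem exists_pos_le {F : S → ℝ} (hF : ∀ i, 0 < F i) : ∃ r, 0 < r ∧ ∀ i, r ≤ F i := by
  rcases isEmpty_or_nonempty S with h | h
  · exact ⟨1, one_pos, fun i => h.elim i⟩
  · obtain ⟨m, hm⟩ := Finite.exists_min F
    exact ⟨F m, hF m, hm⟩

/-- A Lyapunov function for absorption in `B`: a multiple of `1 - θ ^ d` with a small `θ`. -/
theorem exists_lyapunov {Q : Matrix S S ℝ} (hoff : ∀ i j, i ≠ j → 0 ≤ Q i j)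
    (hrow : ∀ i, ∑ j, Q i j = 0) {B : Set S} (hB : ∀ i ∈ B, ∀ j, Q i j = 0) {d : S → ℕ}
    (hd : ∀ i ∉ B, ∃ j, 0 < Q i j ∧ (j ∈ B ∨ d j < d i)) :
    ∃ g : S → ℝ, (∀ i, 0 ≤ g i) ∧ (∀ i ∉ B, 1 ≤ g i) ∧
      ∃ ε : ℝ, 0 < ε ∧ ∀ i, ∑ j, Q i j * g j ≤ -ε * g i := by
  classical
  -- a rank that vanishes exactly on `B`
  let d' : S → ℕ := fun i => if i ∈ B then 0 else d i + 1
  have hd' : ∀ i, ∃ j, i ∉ B → 0 < Q i j ∧ d' j < d' i := fun i => by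
    by_cases hi : i ∈ B
    · exact ⟨i, fun h => absurd hi h⟩
    · obtain ⟨j, hj, h⟩ := hd i hi
      refine ⟨j, fun _ => ⟨hj, ?_⟩⟩
      simp only [d', if_neg hi]
      split_ifs with hjB
      · omega
      · have := h.resolve_left hjB
        omega
  choose J hJ using hd'
  obtain ⟨r, hr, hrQ⟩ := exists_pos_le (F := fun i => if i ∈ B then 1 else Q i (J i)) fun i => by
    split_ifs with hi
    exacts [one_pos, (hJ i hi).1]
  set R : ℝ := ∑ i, ∑ j, |Q i j|
  have hR : 0 ≤ R := Finset.sum_nonneg fun _ _ => Finset.sum_nonneg fun _ _ => abs_nonneg _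
  obtain ⟨θ, hθ, hθ2, hθR⟩ : ∃ θ : ℝ, 0 < θ ∧ θ ≤ 1 / 2 ∧ R * θ < r := by
    refine ⟨min (1 / 2) (r / (R + 1)), by positivity, min_le_left _ _, ?_⟩
    calc R * min (1 / 2) (r / (R + 1)) ≤ R * (r / (R + 1)) :=
          mul_le_mul_of_nonneg_left (min_le_right _ _) hR
      _ < (R + 1) * (r / (R + 1)) := by
          have : 0 < r / (R + 1) := by positivity
          linarith
      _ = r := mul_div_cancel₀ _ (by positivity)
  let g : S → ℝ := fun i => 2 * (1 - θ ^ d' i)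
  have hg : ∀ i, 0 ≤ g i := fun i => by
    have : θ ^ d' i ≤ 1 := pow_le_one₀ hθ.le (by linarith)
    simp only [g]
    linarith
  have hgB : ∀ i ∉ B, 1 ≤ g i := fun i hi => by
    have : θ ^ d' i ≤ θ := pow_le_of_le_one hθ.le (by linarith) (by simp [d', hi])
    simp only [g]
    linarith
  have hneg : ∀ i ∉ B, ∑ j, Q i j * g j < 0 := fun i hi => by
    obtain ⟨hpos, hlt⟩ := hJ i hi
    have hterm : ∀ j, Q i j * (g j - g i)
        ≤ |Q i j| * (2 * θ ^ d' i) - if j = J i then Q i (J i) * (2 * θ ^ (d' i - 1)) else 0 := by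
      intro j
      have hpj : 0 < θ ^ d' j := pow_pos hθ _
      have hpi : 0 < θ ^ d' i := pow_pos hθ _
      have hgj : g j - g i = 2 * θ ^ d' i - 2 * θ ^ d' j := by simp only [g]; ring
      rw [hgj]
      by_cases hj : j = J i
      · subst hj
        rw [if_pos rfl, abs_of_pos hpos, mul_sub]
        have : θ ^ (d' i - 1) ≤ θ ^ d' (J i) :=
          pow_le_pow_of_le_one hθ.le (by linarith) (by omega)
        have := mul_le_mul_of_nonneg_left this hpos.le
        linarith
      · rw [if_neg hj, sub_zero]
        by_cases hij : i = j
        · subst hij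
          rw [sub_self, mul_zero]
          positivity
        · rw [abs_of_nonneg (hoff i j hij)]
          exact mul_le_mul_of_nonneg_left (by linarith) (hoff i j hij)
    have hsum := Finset.sum_le_sum fun j (_ : j ∈ Finset.univ) => hterm j
    simp only [mul_sub, Finset.sum_sub_distrib, ← Finset.sum_mul, hrow, zero_mul, sub_zero,
      Finset.sum_ite_eq', Finset.mem_univ, if_true] at hsum
    have hrow_le : ∑ j, |Q i j| ≤ R := Finset.single_le_sum (f := fun i => ∑ j, |Q i j|)
      (fun _ _ => Finset.sum_nonneg fun _ _ => abs_nonneg _) (Finset.mem_univ i)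
    have hrJ : r ≤ Q i (J i) := by simpa [hi] using hrQ i
    have hp : 0 < θ ^ (d' i - 1) := pow_pos hθ _
    have hsucc : θ ^ d' i = θ * θ ^ (d' i - 1) := by
      rw [← pow_succ', Nat.sub_add_cancel (by omega)]
    calc ∑ j, Q i j * g j
        ≤ (∑ j, |Q i j|) * (2 * θ ^ d' i) - Q i (J i) * (2 * θ ^ (d' i - 1)) := hsum
      _ ≤ R * (2 * θ ^ d' i) - r * (2 * θ ^ (d' i - 1)) := by gcongr
      _ = (R * θ - r) * (2 * θ ^ (d' i - 1)) := by rw [hsucc]; ring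
      _ < 0 := mul_neg_of_neg_of_pos (by linarith) (by positivity)
  obtain ⟨ε, hε, hεg⟩ := exists_pos_le
    (F := fun i => if i ∈ B then 1 else -(∑ j, Q i j * g j) / g i) fun i => by
      split_ifs with hi
      · exact one_pos
      · exact div_pos (neg_pos.2 (hneg i hi)) (by linarith [hgB i hi])
  refine ⟨g, hg, hgB, ε, hε, fun i => ?_⟩
  by_cases hi : i ∈ B
  · simp [hB i hi, g, d', hi]
  · have := hεg i
    rw [if_neg hi, le_div_iff₀ (by linarith [hgB i hi])] at this
    linarith

open NormedSpace in
theorem tendsto_exp_smul_atTop {Q : Matrix S S ℝ} (hoff : ∀ i j, i ≠ j → 0 ≤ Q i j)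
    {B : Set S} {g : S → ℝ} (hg : ∀ i, 0 ≤ g i) (hgB : ∀ i ∉ B, 1 ≤ g i) {ε : ℝ} (hε : 0 < ε)
    (hQg : ∀ i, ∑ j, Q i j * g j ≤ -ε * g i) (a : S) {c : S} (hc : c ∉ B) :
    Tendsto (fun t : ℝ => exp (t • Q) a c) atTop (𝓝 0) := by
  let u : ℝ → ℝ := fun t => ∑ j, exp (t • Q) a j * g j
  have hu : ∀ t, HasDerivAt u (∑ j, (exp (t • Q) * Q) a j * g j) t := fun t =>
    HasDerivAt.fun_sum fun j _ => (hasDerivAt_exp_smul_apply Q a j t).mul_const _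
  have hu' : ∀ t, 0 ≤ t → ∑ j, (exp (t • Q) * Q) a j * g j ≤ -ε * u t := fun t ht => by
    simp only [Matrix.mul_apply, Finset.sum_mul, u, Finset.mul_sum]
    rw [Finset.sum_comm]
    refine Finset.sum_le_sum fun k _ => ?_
    have := mul_le_mul_of_nonneg_left (hQg k) (exp_smul_nonneg hoff ht a k)
    rw [Finset.mul_sum] at this
    simp only [mul_assoc] at this ⊢
    linarith
  have hanti : AntitoneOn (fun t => Real.exp (ε * t) * u t) (Set.Ici 0) := by
    have hder : ∀ t, HasDerivAt (fun t => Real.exp (ε * t) * u t)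
        (Real.exp (ε * t) * (ε * 1) * u t
          + Real.exp (ε * t) * ∑ j, (exp (t • Q) * Q) a j * g j) t := fun t =>
      (((hasDerivAt_id t).const_mul ε).exp).mul (hu t)
    refine antitoneOn_of_deriv_nonpos (convex_Ici 0)
      (fun t _ => (hder t).continuousAt.continuousWithinAt)
      (fun t _ => (hder t).differentiableAt.differentiableWithinAt) fun t ht => ?_
    rw [interior_Ici] at ht
    rw [(hder t).deriv]
    nlinarith [hu' t (le_of_lt ht), Real.exp_pos (ε * t)]
  have hbound : ∀ t, 0 ≤ t → exp (t • Q) a c ≤ u 0 * Real.exp (-(ε * t)) := fun t ht => by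
    have h1 : Real.exp (ε * t) * u t ≤ u 0 := by
      simpa using hanti (Set.mem_Ici.2 le_rfl) (Set.mem_Ici.2 ht) ht
    have h2 : exp (t • Q) a c ≤ u t :=
      calc exp (t • Q) a c ≤ exp (t • Q) a c * g c :=
            le_mul_of_one_le_right (exp_smul_nonneg hoff ht a c) (hgB c hc)
        _ ≤ u t := Finset.single_le_sum (f := fun j => exp (t • Q) a j * g j)
            (fun j _ => mul_nonneg (exp_smul_nonneg hoff ht a j) (hg j)) (Finset.mem_univ c)
    rw [Real.exp_neg, ← div_eq_mul_inv, le_div_iff₀ (Real.exp_pos _)]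
    nlinarith [Real.exp_pos (ε * t)]
  have hlim : Tendsto (fun t : ℝ => u 0 * Real.exp (-(ε * t))) atTop (𝓝 0) := by
    have := (Real.tendsto_exp_neg_atTop_nhds_zero.comp
      (tendsto_id.const_mul_atTop hε)).const_mul (u 0)
    simpa using this
  refine tendsto_of_tendsto_of_tendsto_of_le_of_le' tendsto_const_nhds hlim ?_ ?_
  · filter_upwards [eventually_ge_atTop 0] with t ht using exp_smul_nonneg hoff ht a c
  · filter_upwards [eventually_ge_atTop 0] with t ht using hbound t ht

open NormedSpace in
theorem sum_exp_smul_mul_of_harmonic {Q : Matrix S S ℝ} {h : S → ℝ}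
    (hh : ∀ i, ∑ j, Q i j * h j = 0) (a : S) (t : ℝ) : ∑ j, exp (t • Q) a j * h j = h a := by
  have hder : ∀ t, HasDerivAt (fun t : ℝ => ∑ j, exp (t • Q) a j * h j) 0 t := fun t => by
    refine (HasDerivAt.fun_sum fun j (_ : j ∈ Finset.univ) =>
      (hasDerivAt_exp_smul_apply Q a j t).mul_const (h j)).congr_deriv ?_
    simp only [Matrix.mul_apply, Finset.sum_mul]
    rw [Finset.sum_comm]
    simp only [mul_assoc, ← Finset.mul_sum, hh, mul_zero, Finset.sum_const_zero]
  rw [is_const_of_deriv_eq_zero (fun t => (hder t).differentiableAt) (fun t => (hder t).deriv) t 0]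
  simp [Matrix.one_apply]

/-- The hitting probability of `b` is the function that is harmonic off `b`, is `1` at `b` and
vanishes on the other absorbing states, provided that absorption is certain. -/
theorem hittingProb_eq {Q : Matrix S S ℝ} (hoff : ∀ i j, i ≠ j → 0 ≤ Q i j)
    (hrow : ∀ i, ∑ j, Q i j = 0) {B : Set S} {b : S} (hb : b ∈ B)
    (hB : ∀ i ∈ B, i ≠ b → ∀ j, Q i j = 0) {d : S → ℕ}
    (hd : ∀ i ∉ B, ∃ j, 0 < Q i j ∧ (j ∈ B ∨ d j < d i)) {h : S → ℝ} (h1 : h b = 1)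
    (h0 : ∀ i ∈ B, i ≠ b → h i = 0) (hh : ∀ i ∉ B, ∑ j, Q i j * h j = 0) (a : S) :
    hittingProb Q a b = h a := by
  set Q' := stoppedGenerator Q b with hQ'
  have happ : ∀ i j, Q' i j = if i = b then 0 else Q i j := fun _ _ => rfl
  have hB' : ∀ i ∈ B, ∀ j, Q' i j = 0 := fun i hi j => by
    rw [happ]
    split_ifs with hib
    · rfl
    · exact hB i hi hib j
  have hnb : ∀ i ∉ B, ∀ j, Q' i j = Q i j := fun i hi j => by
    rw [happ, if_neg (ne_of_mem_of_not_mem hb hi).symm]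
  have hoff' : ∀ i j, i ≠ j → 0 ≤ Q' i j := fun i j hij => by
    rw [happ]
    split_ifs
    exacts [le_rfl, hoff i j hij]
  have hrow' : ∀ i, ∑ j, Q' i j = 0 := fun i => by
    simp only [happ]
    split_ifs
    exacts [Finset.sum_const_zero, hrow i]
  have hd' : ∀ i ∉ B, ∃ j, 0 < Q' i j ∧ (j ∈ B ∨ d j < d i) := fun i hi => by
    simpa only [hnb i hi] using hd i hi
  have hh' : ∀ i, ∑ j, Q' i j * h j = 0 := fun i => by
    by_cases hi : i ∈ B
    · simp [hB' i hi]
    · simpa only [hnb i hi] using hh i hi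
  obtain ⟨g, hg, hgB, ε, hε, hQg⟩ := exists_lyapunov hoff' hrow' hB' hd'
  have hlim : ∀ j ∈ Finset.univ.erase b,
      Tendsto (fun t : ℝ => NormedSpace.exp (t • Q') a j * h j) atTop (𝓝 0) := fun j hj => by
    by_cases hjB : j ∈ B
    · simp [h0 j hjB (Finset.ne_of_mem_erase hj)]
    · simpa using (tendsto_exp_smul_atTop hoff' hg hgB hε hQg a hjB).mul_const (h j)
  refine Tendsto.limUnder_eq ?_
  have hsum := (tendsto_const_nhds (x := h a)).sub (tendsto_finsetSum _ hlim)
  simp only [Finset.sum_const_zero, sub_zero] at hsum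
  refine hsum.congr fun t => ?_
  rw [← sum_exp_smul_mul_of_harmonic hh' a t, ← Finset.add_sum_erase _ _ (Finset.mem_univ b), h1]
  ring

end Hitting

/-! ### Visit and stabilisation probabilities as hitting probabilities -/

section Identification

variable {V : Type*} [Fintype V] [DecidableEq V]

theorem sum_delta_sub_mul {S : Type*} [Fintype S] [DecidableEq S] (a a' : S) (h : S → ℝ) :
    ∑ b, (delta a b - delta a' b) * h b = h a - h a' := by
  simp [delta, sub_mul, Finset.sum_sub_distrib]

theorem delta_nonneg {S : Type*} [DecidableEq S] (a b : S) : 0 ≤ delta a b := by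
  unfold delta
  split_ifs <;> norm_num

theorem delta_of_ne {S : Type*} [DecidableEq S] {a b : S} (h : a ≠ b) : delta a b = 0 := if_neg h

theorem delta_self {S : Type*} [DecidableEq S] (a : S) : delta a a = 1 := if_pos rfl

theorem sum_walkGenerator_some (K : Matrix V V ℝ) (x : V) (h : Option V → ℝ) :
    ∑ b, walkGenerator K (some x) b * h b
      = ∑ y, K x y * (h (some y) - h (some x)) + killRate K x * (h none - h (some x)) := by
  simp only [walkGenerator, Matrix.of_apply, add_mul, Finset.sum_mul, Finset.sum_add_distrib]
  rw [Finset.sum_comm]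
  simp only [mul_assoc, ← Finset.mul_sum, sum_delta_sub_mul]

theorem visitProb_eq {K : Matrix V V ℝ} (hK : IsSubstochastic K) (hK' : IsNondegenerate K)
    (ν : V → ℝ) {w : V} {v : V → ℝ} (hv : IsVisitFunction K w v) :
    visitProb K ν w = ∑ y, ν y * v y := by
  obtain ⟨d, hd⟩ := exists_rank hK hK'
  have hkill := killRate_nonneg hK
  refine Finset.sum_congr rfl fun y _ => congrArg _ ?_
  have hoff : ∀ i j, i ≠ j → 0 ≤ walkGenerator K i j := by
    rintro (_ | x) b hb
    · exact le_rfl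
    · simp only [walkGenerator, Matrix.of_apply, delta_of_ne hb, sub_zero]
      exact add_nonneg (Finset.sum_nonneg fun y _ => mul_nonneg (hK.1 x y) (delta_nonneg _ _))
        (mul_nonneg (hkill x) (delta_nonneg _ _))
  refine hittingProb_eq (B := {none, some w}) (b := some w) (d := fun o => o.elim 0 d)
    (h := fun o => o.elim 0 v) hoff ?_ (by simp) ?_ ?_ hv.1 ?_ ?_ (some y)
  · rintro (_ | x)
    · exact Finset.sum_const_zero
    · simpa using sum_walkGenerator_some K x fun _ => 1
  · rintro i (rfl | rfl) hi j
    · rfl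
    · exact absurd rfl hi
  · rintro (_ | x) hx
    · simp at hx
    rcases hd x with h | ⟨u, hu, hlt⟩
    · refine ⟨none, ?_, Or.inl (by simp)⟩
      simp only [walkGenerator, Matrix.of_apply, delta_self,
        delta_of_ne (Option.some_ne_none _), sub_zero, mul_one]
      simpa using h
    · refine ⟨some u, ?_, Or.inr hlt⟩
      have hxu : some x ≠ some u := fun h => by
        rw [Option.some.inj h] at hlt
        exact lt_irrefl _ hlt
      simp only [walkGenerator, Matrix.of_apply, delta_of_ne hxu, sub_zero]
      refine add_pos_of_pos_of_nonneg (Finset.sum_pos'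
        (fun y _ => mul_nonneg (hK.1 x y) (delta_nonneg _ _)) ⟨u, Finset.mem_univ u, ?_⟩)
        (mul_nonneg (hkill x) (delta_nonneg _ _))
      simpa [delta_self] using hu
  · rintro i (rfl | rfl) hi
    · rfl
    · exact absurd rfl hi
  · rintro (_ | x) hx
    · simp at hx
    have hxw : x ≠ w := fun h => hx (by simp [h])
    rw [sum_walkGenerator_some]
    simp only [Option.elim_some, Option.elim_none, mul_sub, Finset.sum_sub_distrib,
      ← hv.2 x hxw, ← Finset.sum_mul, killRate]
    ring

/-- An active site with `k` particles executes each jump at `k` times its rate; an instruction to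
fall asleep is effective only if `k = 1`. -/
theorem arwRate_eq (K : Matrix V V ℝ) (lam : ℝ) (η ξ : V → SiteState) :
    arwRate K lam η ξ
      = ∑ x, ((η x).numActive : ℝ) * topple K lam x (fun ζ => delta ζ ξ) η := by
  refine Finset.sum_congr rfl fun x _ => ?_
  rw [topple_eq]
  by_cases h : η x = SiteState.active 1
  · simp only [h, if_true, instrAct, SiteState.numActive, smul_eq_mul, Nat.cast_one]
    ring
  · simp only [h, if_false, instrAct, smul_eq_mul]
    ring

theorem sum_arwGenerator (K : Matrix V V ℝ) (lam : ℝ) {N : ℕ} (η : Config V N)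
    (h : (V → SiteState) → ℝ) :
    ∑ ξ, arwGenerator K lam N η ξ * h ξ.1
      = ∑ x, ((η.1 x).numActive : ℝ) * topple K lam x h η.1 := by
  simp only [arwGenerator, Matrix.of_apply, arwRate_eq, Finset.sum_mul]
  rw [Finset.sum_comm]
  refine Finset.sum_congr rfl fun x _ => ?_
  by_cases hx : 0 < (η.1 x).numActive
  · simp only [topple, mul_assoc, ← Finset.mul_sum, Finset.sum_mul]
    rw [Finset.sum_comm]
    congr 1
    refine Finset.sum_congr rfl fun i _ => ?_
    have hdelta : ∀ ζ ξ : Config V N, delta ζ ξ = delta ζ.1 ξ.1 := fun ζ ξ =>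
      if_congr Subtype.ext_iff rfl rfl
    let ζ : Config V N := ⟨instrAct x i η.1, (sum_numParticles_instrAct_le hx i).trans η.2⟩
    have hsub := sum_delta_sub_mul ζ η fun ξ => h ξ.1
    simp only [hdelta] at hsub
    rw [smul_eq_mul, ← hsub, Finset.mul_sum]
    exact Finset.sum_congr rfl fun ξ _ => by rw [smul_eq_mul, mul_assoc]
  · simp [Nat.eq_zero_of_not_pos hx]

theorem hittingProb_arwGenerator {K : Matrix V V ℝ} (hK : IsSubstochastic K)
    (hK' : IsNondegenerate K) {lam : ℝ} (hlam : 0 ≤ lam) {ξ : V → Bool}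
    {h : (V → SiteState) → ℝ} (h1 : h (ofStable ξ) = 1)
    (h0 : ∀ ξ', ξ' ≠ ξ → h (ofStable ξ') = 0) (hh : IsSiteHarmonic K lam h)
    (η : Config V (Fintype.card V + 1)) :
    hittingProb (arwGenerator K lam (Fintype.card V + 1)) η (stableConfig ξ) = h η.1 := by
  obtain ⟨d, hd⟩ : ∃ d, IsRank K d := exists_rank hK hK'
  have hzero : ∀ (η : Config V (Fintype.card V + 1)) (f : (V → SiteState) → ℝ),
      (∀ z, 0 < (η.1 z).numActive → topple K lam z f η.1 = 0) →
      ∑ x, ((η.1 x).numActive : ℝ) * topple K lam x f η.1 = 0 := fun η f hf =>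
    Finset.sum_eq_zero fun x _ => by
      rcases Nat.eq_zero_or_pos (η.1 x).numActive with hx | hx
      · simp [hx]
      · rw [hf x hx, mul_zero]
  have hterm : ∀ η ζ : V → SiteState, η ≠ ζ → ∀ x,
      0 ≤ topple K lam x (fun ζ' => delta ζ' ζ) η := fun η ζ hne x =>
    Finset.sum_nonneg fun i _ => by
      dsimp only
      rw [delta_of_ne hne, sub_zero]
      exact mul_nonneg (instrRate_nonneg hK hlam x i) (delta_nonneg _ _)
  refine hittingProb_eq (b := stableConfig ξ) (B := {η | ∀ z, ¬ 0 < (η.1 z).numActive})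
    (d := fun η => energy d η.1) (h := fun η => h η.1) ?_ ?_ ?_ ?_ ?_ h1 ?_ ?_ η
  · intro η ζ hne
    have hne' : η.1 ≠ ζ.1 := fun h => hne (Subtype.ext h)
    rw [arwGenerator, Matrix.of_apply, arwRate_eq]
    exact Finset.sum_nonneg fun x _ => mul_nonneg (Nat.cast_nonneg _) (hterm _ _ hne' x)
  · intro η
    have := sum_arwGenerator K lam η fun _ => 1
    simp only [mul_one] at this
    rw [this]
    exact hzero η _ fun z _ => by simp [topple]
  · intro z
    simp [stableConfig, numActive_ofStable]
  · intro η hη _ ζ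
    rw [arwGenerator, Matrix.of_apply, arwRate_eq]
    exact hzero η _ fun z hz => absurd hz (hη z)
  · intro η hη
    obtain ⟨z, hz⟩ := not_forall_not.1 hη
    obtain ⟨i, hi, hlt⟩ := hd.exists_energy_lt lam hz
    have hne : η.1 ≠ instrAct z i η.1 := fun h => by
      rw [← h] at hlt
      exact lt_irrefl _ hlt
    refine ⟨⟨instrAct z i η.1, (sum_numParticles_instrAct_le hz i).trans η.2⟩, ?_, Or.inr hlt⟩
    change 0 < arwRate K lam η.1 (instrAct z i η.1)
    rw [arwRate_eq]
    refine Finset.sum_pos' (fun x _ => mul_nonneg (Nat.cast_nonneg _) (hterm _ _ hne x))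
      ⟨z, Finset.mem_univ z, mul_pos (Nat.cast_pos.2 hz) ?_⟩
    refine Finset.sum_pos' (fun j _ => ?_) ⟨i, Finset.mem_univ i, ?_⟩
    · dsimp only
      rw [delta_of_ne hne, sub_zero]
      exact mul_nonneg (instrRate_nonneg hK hlam z j) (delta_nonneg _ _)
    · dsimp only
      rw [delta_of_ne hne, delta_self]
      simpa using hi
  · intro η hη hne
    obtain ⟨ξ', hξ'⟩ := exists_ofStable_eq hη
    rw [← hξ']
    refine h0 ξ' fun h => hne (Subtype.ext ?_)
    rw [← hξ', h]
    rfl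
  · intro η _
    rw [sum_arwGenerator]
    exact hzero η _ fun z hz => hh _ z hz

end Identification

/-! ### Configurations with at most one particle per site -/

section Spectrum

variable {V : Type*} [Fintype V] [DecidableEq V]

/-- Every site carries at most one particle, active or sleeping. -/
def IsSmall {V : Type*} (η : V → SiteState) : Prop := ∀ x, (η x).numParticles ≤ 1

/-- Put one active particle at `x` instead of what is there. -/
def wakeAt {V : Type*} [DecidableEq V] (η : V → SiteState) (x : V) : V → SiteState :=
  Function.update η x (SiteState.active 1)

omit [Fintype V] in
theorem IsSmall.update {η : V → SiteState} (hη : IsSmall η) (x : V) {s : SiteState}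
    (hs : s.numParticles ≤ 1) : IsSmall (Function.update η x s) := fun y => by
  by_cases h : y = x
  · subst h; simpa using hs
  · simpa [h] using hη y

omit [Fintype V] [DecidableEq V] in
theorem IsSmall.cases {η : V → SiteState} (hη : IsSmall η) (x : V) :
    η x = SiteState.sleeping ∨ η x = SiteState.active 0 ∨ η x = SiteState.active 1 := by
  have := hη x
  cases e : η x with
  | sleeping => simp
  | active k =>
    rw [e] at this
    have hk : k ≤ 1 := this
    interval_cases k <;> simp

omit [Fintype V] [DecidableEq V] in
theorem isSmall_ofStable (ξ : V → Bool) : IsSmall (ofStable ξ) := fun x => by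
  unfold ofStable
  split_ifs <;> simp [SiteState.numParticles]

/-- The number of sites that do not carry exactly one active particle. -/
def numQuiet (η : V → SiteState) : ℕ :=
  (Finset.univ.filter fun x => η x ≠ SiteState.active 1).card

theorem numQuiet_wakeAt_lt {η : V → SiteState} {x : V} (hx : η x ≠ SiteState.active 1) :
    numQuiet (wakeAt η x) < numQuiet η := by
  refine Finset.card_lt_card ⟨fun y hy => ?_, fun h => ?_⟩
  · by_cases hyx : y = x
    · subst hyx; simpa using hx
    · have := (Finset.mem_filter.1 hy).2
      simpa [wakeAt, hyx] using this
  · have : x ∈ Finset.univ.filter fun y => wakeAt η x y ≠ SiteState.active 1 :=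
      h (by simpa using hx)
    exact (Finset.mem_filter.1 this).2 (by simp [wakeAt])

section Harmonic

variable {K : Matrix V V ℝ} {lam : ℝ} {E : Type*} [NormedAddCommGroup E] [NormedSpace ℝ E]
  {ψ : (V → SiteState) → E}

/-- A particle added to a site with one active particle makes one step of a `K`-walk: while there
are two particles at the site, neither can fall asleep. -/
theorem IsSiteHarmonic.insertAt_of_active (hψ : IsSiteHarmonic K lam ψ) {η : V → SiteState} {x : V}
    (hx : η x = SiteState.active 1) :
    ψ (insertAt η x) = ∑ u, K x u • ψ (insertAt η u) + killRate K x • ψ η := by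
  have h := hψ (insertAt η x) x (numActive_insertAt_self η x)
  have h2 : insertAt η x x ≠ SiteState.active 1 := by simp [insertAt, hx, SiteState.arrive]
  have hpos : 0 < (η x).numActive := by rw [hx]; exact one_pos
  rw [topple_eq, removeAt_insertAt_self hpos] at h
  simp only [instrAct, if_neg h2, sub_self, smul_zero, zero_add, smul_sub,
    Finset.sum_sub_distrib, ← Finset.sum_smul] at h
  have hk : ∑ u, K x u = 1 - killRate K x := by simp [killRate]
  rw [hk, sub_smul, one_smul] at h
  rw [eq_comm, ← sub_eq_zero, ← h]
  abel

omit [Fintype V] in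
theorem insertAt_eq_of_quiet {η : V → SiteState} (hη : IsSmall η) {x : V}
    (hx : η x ≠ SiteState.active 1) :
    insertAt η x = wakeAt η x ∨ insertAt η x = insertAt (wakeAt η x) x := by
  rcases hη.cases x with h | h | h
  · right; simp [insertAt, wakeAt, h, SiteState.arrive]
  · left; simp [insertAt, wakeAt, h, SiteState.arrive]
  · exact absurd h hx

/-- If a harmonic function vanishes on a set of small configurations that is closed under waking up
sites, then it still vanishes after a particle has been added: this particle walks until it is
killed or settles at an empty site. -/
theorem IsSiteHarmonic.insertAt_eq_zero (hK : IsSubstochastic K) (hK' : IsNondegenerate K)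
    (hψ : IsSiteHarmonic K lam ψ) {C : Set (V → SiteState)} (hC : ∀ η ∈ C, IsSmall η)
    (hCw : ∀ η ∈ C, ∀ x, η x ≠ SiteState.active 1 → wakeAt η x ∈ C) (h0 : ∀ η ∈ C, ψ η = 0)
    {η : V → SiteState} (hη : η ∈ C) (x : V) : ψ (insertAt η x) = 0 := by
  induction hn : numQuiet η using Nat.strong_induction_on generalizing η x with
  | _ n ih =>
    refine eq_zero_of_harmonic hK hK' (φ := fun x => ψ (insertAt η x)) (fun y => ?_) x
    by_cases hy : η y = SiteState.active 1
    · right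
      rw [hψ.insertAt_of_active hy, h0 η hη, smul_zero, add_zero]
    · left
      rcases insertAt_eq_of_quiet (hC η hη) hy with h | h
      · simpa only [h] using h0 _ (hCw η hη y hy)
      · simpa only [h] using ih _ (hn ▸ numQuiet_wakeAt_lt hy) (hCw η hη y hy) y rfl

/-- The same for a configuration from which waking up any site leads into the set where `ψ`
vanishes. -/
theorem IsSiteHarmonic.insertAt_eq_zero_of_quiet (hK : IsSubstochastic K)
    (hK' : IsNondegenerate K) (hψ : IsSiteHarmonic K lam ψ) {C : Set (V → SiteState)}
    (hC : ∀ η ∈ C, IsSmall η)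
    (hCw : ∀ η ∈ C, ∀ x, η x ≠ SiteState.active 1 → wakeAt η x ∈ C) (h0 : ∀ η ∈ C, ψ η = 0)
    {η : V → SiteState} (hη : IsSmall η) {x : V} (hx : η x ≠ SiteState.active 1)
    (hxC : wakeAt η x ∈ C) : ψ (insertAt η x) = 0 := by
  rcases insertAt_eq_of_quiet hη hx with h | h
  · rw [h]; exact h0 _ hxC
  · rw [h]; exact hψ.insertAt_eq_zero hK hK' hC hCw h0 hxC x

/-- One active particle at each `x` with `a x = true`, the other sites being empty. -/
def ofActive {V : Type*} (a : V → Bool) : V → SiteState :=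
  fun x => SiteState.active (if a x then 1 else 0)

/-- A harmonic function is determined by its values on the configurations without sleeping
particles: a sleeping particle at `w` is produced by toppling an active one, and all other outcomes
of this toppling have fewer sleeping particles. -/
theorem IsSiteHarmonic.eq_zero_of_ofActive (hK : IsSubstochastic K) (hK' : IsNondegenerate K)
    (hlam : 0 < lam) (hψ : IsSiteHarmonic K lam ψ) (h0 : ∀ a, ψ (ofActive a) = 0)
    {η : V → SiteState} (hη : IsSmall η) : ψ η = 0 := by
  let ns : (V → SiteState) → ℕ := fun η =>
    (Finset.univ.filter fun x => η x = SiteState.sleeping).card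
  have hns : ∀ (η : V → SiteState) (x : V) (k : ℕ),
      ns (Function.update η x (SiteState.active k)) ≤ ns η := fun η x k =>
    Finset.card_le_card fun y hy => by
      by_cases h : y = x
      · subst h; simp at hy
      · simpa [h] using hy
  have hns' : ∀ (η : V → SiteState) (x : V) (k : ℕ), η x = SiteState.sleeping →
      ns (Function.update η x (SiteState.active k)) < ns η := fun η x k hx => by
    refine lt_of_le_of_ne (hns η x k) fun h => ?_
    have hsub : (Finset.univ.filter fun y =>
        Function.update η x (SiteState.active k) y = SiteState.sleeping) ⊆
        Finset.univ.filter fun y => η y = SiteState.sleeping := fun y hy => by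
      by_cases h : y = x
      · subst h; simp at hy
      · simpa [h] using hy
    have := Finset.eq_of_subset_of_card_le hsub h.ge
    have hx' : x ∈ Finset.univ.filter fun y => η y = SiteState.sleeping := by simpa using hx
    rw [← this] at hx'
    simp at hx'
  induction hn : ns η using Nat.strong_induction_on generalizing η with
  | _ n ih =>
    by_cases hw : ∃ w, η w = SiteState.sleeping
    · obtain ⟨w, hw⟩ := hw
      set ζ := wakeAt η w with hζ
      have hζw : ζ w = SiteState.active 1 := by simp [hζ, wakeAt]
      have hrem : removeAt ζ w = Function.update η w (SiteState.active 0) := by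
        simp [removeAt, hζ, wakeAt, SiteState.depart]
      have hsleep : sleepAt ζ w = η := by
        simp [sleepAt, hζ, wakeAt, ← hw]
      have hsm : ∀ s : SiteState, s.numParticles ≤ 1 → IsSmall (Function.update η w s) :=
        fun s hs => hη.update w hs
      have h1 : ψ ζ = 0 := ih _ (hn ▸ hns' η w 1 hw) (hsm _ le_rfl) rfl
      have h2 : ψ (removeAt ζ w) = 0 := by
        rw [hrem]
        exact ih _ (hn ▸ hns' η w 0 hw) (hsm _ zero_le_one) rfl
      have h3 : ∀ u, ψ (insertAt (removeAt ζ w) u) = 0 := fun u => by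
        refine hψ.insertAt_eq_zero hK hK' (C := {η | IsSmall η ∧ ns η < n}) (fun _ h => h.1)
          (fun η h x _ => ⟨h.1.update x le_rfl, (hns η x 1).trans_lt h.2⟩)
          (fun η h => ih _ h.2 h.1 rfl) ?_ u
        rw [hrem]
        exact ⟨hsm _ zero_le_one, hn ▸ hns' η w 0 hw⟩
      have h := hψ ζ w (by rw [hζw]; exact one_pos)
      rw [topple_eq] at h
      simpa [instrAct, hζw, hsleep, h1, h2, h3, hlam.ne'] using h
    · have : η = ofActive fun x => decide (η x = SiteState.active 1) := funext fun x => by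
        rcases hη.cases x with h | h | h
        · exact absurd ⟨x, h⟩ hw
        · simp [ofActive, h]
        · simp [ofActive, h]
      rw [this]
      exact h0 _

end Harmonic

end Spectrum

/-! ### The spectrum of the chain -/

section Chain

variable {V : Type*} [Fintype V] [DecidableEq V]

/-- `h ξ η` is the probability that `η` stabilises in `ξ`. -/
def IsStabilisation (K : Matrix V V ℝ) (lam : ℝ) (h : (V → Bool) → (V → SiteState) → ℝ) : Prop :=
  ∀ ξ, h ξ (ofStable ξ) = 1 ∧ (∀ ξ', ξ' ≠ ξ → h ξ (ofStable ξ') = 0) ∧ IsSiteHarmonic K lam (h ξ)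

/-- The expected value of `f` at the stabilisation of a configuration. -/
def stabExpectation (h : (V → Bool) → (V → SiteState) → ℝ) (η : V → SiteState) :
    ((V → Bool) → ℂ) →ₗ[ℂ] ℂ :=
  ∑ ξ, (h ξ η : ℂ) • LinearMap.proj ξ

theorem stabExpectation_apply (h : (V → Bool) → (V → SiteState) → ℝ) (η : V → SiteState)
    (f : (V → Bool) → ℂ) : stabExpectation h η f = ∑ ξ, (h ξ η : ℂ) * f ξ := by
  simp [stabExpectation]

variable {K : Matrix V V ℝ} {lam : ℝ} {ν : V → ℝ} {h : (V → Bool) → (V → SiteState) → ℝ}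

namespace IsStabilisation

theorem stabExpectation_ofStable (hh : IsStabilisation K lam h) (f : (V → Bool) → ℂ)
    (ξ : V → Bool) : stabExpectation h (ofStable ξ) f = f ξ := by
  rw [stabExpectation_apply, Finset.sum_eq_single ξ]
  · simp [(hh ξ).1]
  · intro ξ' _ hne
    simp [(hh ξ').2.1 ξ hne.symm]
  · simp

theorem isSiteHarmonic (hh : IsStabilisation K lam h) (f : (V → Bool) → ℂ) :
    IsSiteHarmonic K lam fun η => stabExpectation h η f := by
  simp only [stabExpectation_apply]
  refine IsSiteHarmonic.sum _ fun ξ _ η z hz => ?_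
  have h1 := (hh ξ).2.2 η z hz
  have h2 : topple K lam z (fun η => (h ξ η : ℂ) * f ξ) η
      = ((topple K lam z (h ξ) η : ℝ) : ℂ) * f ξ := by
    simp only [topple, Complex.ofReal_sum, Finset.sum_mul, Complex.real_smul, smul_eq_mul,
      Complex.ofReal_mul, Complex.ofReal_sub]
    exact Finset.sum_congr rfl fun i _ => by ring
  rw [h2, h1, Complex.ofReal_zero, zero_mul]

theorem arwMatrix_mulVec (hh : IsStabilisation K lam h) (hK : IsSubstochastic K)
    (hK' : IsNondegenerate K) (hlam : 0 ≤ lam) (f : (V → Bool) → ℂ) (η : V → Bool) :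
    Matrix.toLin' ((arwMatrix K lam ν).map Complex.ofReal) f η
      = ∑ x, ν x • stabExpectation h (insertAt (ofStable η) x) f := by
  have hhit : ∀ ξ x, hittingProb (arwGenerator K lam (Fintype.card V + 1)) (perturbedConfig η x)
      (stableConfig ξ) = h ξ (insertAt (ofStable η) x) := fun ξ x =>
    hittingProb_arwGenerator hK hK' hlam (hh ξ).1 (hh ξ).2.1 (hh ξ).2.2 _
  simp only [Matrix.toLin'_apply, Matrix.mulVec, dotProduct, Matrix.map_apply, arwMatrix,
    Matrix.of_apply, hhit, stabExpectation_apply, Complex.ofReal_sum, Complex.ofReal_mul,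
    Finset.sum_mul, Finset.smul_sum, Complex.real_smul]
  rw [Finset.sum_comm]
  simp only [mul_assoc]

/-- By the abelian property, the particle of the next step of the chain can be added before the
configuration is stable. -/
theorem stabExpectation_arwMatrix (hh : IsStabilisation K lam h) (hK : IsSubstochastic K)
    (hK' : IsNondegenerate K) (hlam : 0 ≤ lam) (f : (V → Bool) → ℂ) (η : V → SiteState) :
    stabExpectation h η (Matrix.toLin' ((arwMatrix K lam ν).map Complex.ofReal) f)
      = ∑ x, ν x • stabExpectation h (insertAt η x) f := by
  rw [← sub_eq_zero]
  refine eq_zero_of_isSiteHarmonic (ψ := fun η =>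
    stabExpectation h η (Matrix.toLin' ((arwMatrix K lam ν).map Complex.ofReal) f)
      - ∑ x, ν x • stabExpectation h (insertAt η x) f) hK hK' hlam ?_ (fun ξ => ?_) η
  · intro η z hz
    have h1 := hh.isSiteHarmonic (Matrix.toLin' ((arwMatrix K lam ν).map Complex.ofReal) f) η z hz
    have h2 := IsSiteHarmonic.sum (K := K) (lam := lam) Finset.univ
      (ψ := fun x η => ν x • stabExpectation h (insertAt η x) f) (fun x _ η z hz => by
        have := (hh.isSiteHarmonic f).comp_insertAt x η z hz
        simp only [topple] at this ⊢
        simp only [← smul_sub, smul_comm _ (ν x), ← Finset.smul_sum, this, smul_zero]) η z hz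
    simp only [topple] at h1 h2 ⊢
    rw [← sub_zero (0 : ℂ)]
    nth_rewrite 1 [← h1]
    rw [← h2, ← Finset.sum_sub_distrib]
    exact Finset.sum_congr rfl fun i _ => by module
  · rw [hh.stabExpectation_ofStable, hh.arwMatrix_mulVec hK hK' hlam, sub_self]

/-- Each eigenvalue other than `1` is at most `1 - p(w)` in modulus for some site `w`. In an
eigenfunction, consider a small configuration with the largest number of active sites at which the
extension does not vanish: an added particle contributes only if it avoids the quiet sites. -/
theorem norm_eigenvalue_le (hh : IsStabilisation K lam h) (hK : IsSubstochastic K)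
    (hK' : IsNondegenerate K) (hlam : 0 ≤ lam) (hν : ∀ x, 0 ≤ ν x) (hν1 : ∑ x, ν x = 1) {z : ℂ}
    (hz : Module.End.HasEigenvalue (Matrix.toLin' ((arwMatrix K lam ν).map Complex.ofReal)) z)
    (hz1 : z ≠ 1) : ∃ w, ‖z‖ ≤ 1 - visitProb K ν w := by
  obtain ⟨f, hf⟩ := hz.exists_hasEigenvector
  have hPf := hf.apply_eq_smul
  obtain ⟨ξ, hξ⟩ := Function.ne_iff.1 hf.2
  have hex : ∃ n, ∃ η, IsSmall η ∧ stabExpectation h η f ≠ 0 ∧ numQuiet η = n :=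
    ⟨_, ofStable ξ, isSmall_ofStable ξ, by rwa [hh.stabExpectation_ofStable], rfl⟩
  classical
  obtain ⟨η, hη, hne, hn⟩ := Nat.find_spec hex
  have hmin := fun m => Nat.find_min hex (m := m)
  rw [← hn] at hmin
  have hharm := hh.isSiteHarmonic f
  have heq : z * stabExpectation h η f = ∑ x, ν x • stabExpectation h (insertAt η x) f := by
    rw [← hh.stabExpectation_arwMatrix hK hK' hlam, hPf, map_smul, smul_eq_mul]
  have hactive : ∀ x, η x = SiteState.active 1 → stabExpectation h (insertAt η x) f
      = ∑ y, K x y • stabExpectation h (insertAt η y) f + killRate K x • stabExpectation h η f :=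
    fun x hx => hharm.insertAt_of_active hx
  have hquiet : ∀ x, η x ≠ SiteState.active 1 → stabExpectation h (insertAt η x) f = 0 :=
    fun x hx => hharm.insertAt_eq_zero_of_quiet hK hK'
      (C := {ζ | IsSmall ζ ∧ numQuiet ζ < numQuiet η}) (fun _ h => h.1)
      (fun ζ hζ y hy => ⟨hζ.1.update y le_rfl, (numQuiet_wakeAt_lt hy).trans hζ.2⟩)
      (fun ζ hζ => by_contra fun h0 => hmin _ hζ.2 ⟨ζ, hζ.1, h0, rfl⟩) hη hx
      ⟨hη.update x le_rfl, numQuiet_wakeAt_lt hx⟩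
  set c := stabExpectation h η f with hc
  by_cases hw : ∃ w, η w ≠ SiteState.active 1
  · obtain ⟨w, hw⟩ := hw
    refine ⟨w, ?_⟩
    obtain ⟨v, hv⟩ := exists_isVisitFunction hK hK' w
    have hcpos : 0 < ‖c‖ := norm_pos_iff.2 hne
    have hle : ∀ x, ‖stabExpectation h (insertAt η x) f‖ ≤ ‖c‖ * (1 - v x) := fun x => by
      rw [← sub_nonpos]
      refine nonpos_of_subharmonic (D := fun x =>
        ‖stabExpectation h (insertAt η x) f‖ - ‖c‖ * (1 - v x)) hK hK' (fun x => ?_) x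
      by_cases hx : η x = SiteState.active 1
      · right
        have hxw : x ≠ w := fun h => hw (h ▸ hx)
        have h1 : ‖stabExpectation h (insertAt η x) f‖
            ≤ ∑ y, K x y * ‖stabExpectation h (insertAt η y) f‖ + killRate K x * ‖c‖ := by
          rw [hactive x hx]
          refine (norm_add_le _ _).trans (add_le_add ((norm_sum_le _ _).trans_eq ?_) ?_)
          · simp only [norm_smul, Real.norm_of_nonneg (hK.1 x _)]
          · rw [norm_smul, Real.norm_of_nonneg (killRate_nonneg hK x)]
        have h2 : ‖c‖ * (1 - v x) = ∑ y, K x y * (‖c‖ * (1 - v y)) + killRate K x * ‖c‖ := by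
          rw [hv.one_sub hxw, mul_add, Finset.mul_sum]
          congr 1
          · exact Finset.sum_congr rfl fun y _ => by ring
          · ring
        simp only [mul_sub (K x _), Finset.sum_sub_distrib]
        linarith
      · left
        rw [hquiet x hx, norm_zero, zero_sub, neg_nonpos]
        exact mul_nonneg hcpos.le (sub_nonneg.2 (hv.le_one hK hK' x))
    rw [visitProb_eq hK hK' ν hv]
    refine le_of_mul_le_mul_right ?_ hcpos
    calc ‖z‖ * ‖c‖ = ‖∑ x, ν x • stabExpectation h (insertAt η x) f‖ := by
          rw [← norm_mul, heq]
      _ ≤ ∑ x, ν x * (‖c‖ * (1 - v x)) := (norm_sum_le _ _).trans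
          (Finset.sum_le_sum fun x _ => by
            rw [norm_smul, Real.norm_of_nonneg (hν x)]
            exact mul_le_mul_of_nonneg_left (hle x) (hν x))
      _ = (∑ x, ν x - ∑ x, ν x * v x) * ‖c‖ := by
          rw [← Finset.sum_sub_distrib, Finset.sum_mul]
          exact Finset.sum_congr rfl fun x _ => by ring
      _ = (1 - ∑ x, ν x * v x) * ‖c‖ := by rw [hν1]
  · -- with all sites active, an added particle walks until it is killed
    push Not at hw
    have hsub : ∀ x, stabExpectation h (insertAt η x) f - c = 0 :=
      eq_zero_of_harmonic hK hK' fun x => Or.inr (by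
        rw [hactive x (hw x)]
        simp only [smul_sub, Finset.sum_sub_distrib, ← Finset.sum_smul, killRate, sub_smul,
          one_smul]
        abel)
    refine absurd ?_ hz1
    simp only [sub_eq_zero] at hsub
    simp only [hsub, ← Finset.sum_smul, hν1, one_smul] at heq
    exact mul_right_cancel₀ hne (heq.trans (one_mul c).symm)

/-- The probability `1 - p(w)` to avoid `w` is an eigenvalue: the difference between the laws of the
stabilisations of the configurations with one active particle at each site, respectively at each
site but `w`, is a left eigenvector. -/
theorem hasEigenvalue_one_sub (hh : IsStabilisation K lam h) (hK : IsSubstochastic K)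
    (hK' : IsNondegenerate K) (hlam : 0 < lam) (hν1 : ∑ x, ν x = 1) (w : V) :
    Module.End.HasEigenvalue (Matrix.toLin' ((arwMatrix K lam ν).map Complex.ofReal))
      ((1 - visitProb K ν w : ℝ) : ℂ) := by
  set P := Matrix.toLin' ((arwMatrix K lam ν).map Complex.ofReal) with hP
  obtain ⟨v, hv⟩ := exists_isVisitFunction hK hK' w
  set full : V → SiteState := ofActive fun _ => true with hfull
  set hole : V → SiteState := ofActive fun x => decide (x ≠ w) with hhole
  have hfull1 : ∀ x, full x = SiteState.active 1 := fun x => by simp [hfull, ofActive]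
  have hhole1 : ∀ x, x ≠ w → hole x = SiteState.active 1 := fun x hx => by
    simp [hhole, ofActive, hx]
  have hins : insertAt hole w = full := funext fun x => by
    by_cases hx : x = w
    · subst hx; simp [insertAt, hhole, hfull, ofActive, SiteState.arrive]
    · simp [insertAt, hx, hfull1, hhole1]
  -- a particle added to `full` is eventually killed
  have h1 : ∀ f x, stabExpectation h (insertAt full x) f = stabExpectation h full f := fun f x => by
    rw [← sub_eq_zero]
    refine eq_zero_of_harmonic (φ := fun x =>
      stabExpectation h (insertAt full x) f - stabExpectation h full f) hK hK'
      (fun x => Or.inr ?_) x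
    rw [(hh.isSiteHarmonic f).insertAt_of_active (hfull1 x)]
    simp only [smul_sub, Finset.sum_sub_distrib, ← Finset.sum_smul, killRate, sub_smul, one_smul]
    abel
  -- a particle added to `hole` settles at `w`, if it gets there
  have h2 : ∀ f x, stabExpectation h (insertAt hole x) f = v x • stabExpectation h full f
      + (1 - v x) • stabExpectation h hole f := fun f x => by
    rw [← sub_eq_zero]
    refine eq_zero_of_harmonic (φ := fun x => stabExpectation h (insertAt hole x) f
      - (v x • stabExpectation h full f + (1 - v x) • stabExpectation h hole f)) hK hK'
      (fun x => ?_) x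
    by_cases hx : x = w
    · left
      subst hx
      simp [hins, hv.1]
    · right
      rw [(hh.isSiteHarmonic f).insertAt_of_active (hhole1 x hx), hv.one_sub hx, hv.2 x hx]
      simp only [smul_sub, smul_add, Finset.sum_sub_distrib, Finset.sum_add_distrib, smul_smul,
        ← Finset.sum_smul, add_smul]
      abel
  let ℓ : ((V → Bool) → ℂ) →ₗ[ℂ] ℂ := stabExpectation h hole - stabExpectation h full
  have hℓ : ∀ f, ℓ (P f) = ((1 - visitProb K ν w : ℝ) : ℂ) * ℓ f := fun f => by
    have e1 : stabExpectation h full (P f) = stabExpectation h full f := by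
      rw [hP, hh.stabExpectation_arwMatrix hK hK' hlam.le]
      simp only [h1, ← Finset.sum_smul, hν1, one_smul]
    have e2 : stabExpectation h hole (P f) = visitProb K ν w • stabExpectation h full f
        + (1 - visitProb K ν w) • stabExpectation h hole f := by
      rw [hP, hh.stabExpectation_arwMatrix hK hK' hlam.le, visitProb_eq hK hK' ν hv]
      simp only [h2, smul_add, smul_smul, Finset.sum_add_distrib, ← Finset.sum_smul, mul_sub,
        mul_one, Finset.sum_sub_distrib, hν1]
    simp only [ℓ, LinearMap.sub_apply, e1, e2, Complex.real_smul]
    push_cast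
    ring
  -- `ℓ` is not zero since the stabilisation laws of the configurations `ofActive a` are linearly
  -- independent
  obtain ⟨f, hf⟩ : ∃ f, ℓ f ≠ 0 := by
    let Λ : ((V → Bool) → ℂ) →ₗ[ℂ] ((V → Bool) → ℂ) :=
      LinearMap.pi fun a => stabExpectation h (ofActive a)
    have hinj : Function.Injective Λ := by
      rw [injective_iff_map_eq_zero]
      intro f hf
      ext ξ
      rw [← hh.stabExpectation_ofStable f ξ]
      exact (hh.isSiteHarmonic f).eq_zero_of_ofActive hK hK' hlam (fun a => congrFun hf a)
        (isSmall_ofStable ξ)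
    obtain ⟨f, hf⟩ := LinearMap.injective_iff_surjective.1 hinj (Pi.single (fun _ => true) 1)
    refine ⟨f, ?_⟩
    have e1 : stabExpectation h full f = 1 := by
      simpa [Λ] using congrFun hf fun _ => true
    have hne : (fun x => decide (x ≠ w)) ≠ fun _ : V => true := fun h => by
      simpa using congrFun h w
    have e2 : stabExpectation h hole f = 0 :=
      (congrFun hf fun x => decide (x ≠ w)).trans (Pi.single_eq_of_ne hne _)
    simp [ℓ, e1, e2]
  -- the range of `P - (1 - p(w))` is contained in the kernel of `ℓ`
  rw [Module.End.hasEigenvalue_iff, Module.End.eigenspace_def]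
  intro hker
  obtain ⟨g, hg⟩ := LinearMap.injective_iff_surjective.1 (LinearMap.ker_eq_bot.1 hker) f
  have hPg : P g - ((1 - visitProb K ν w : ℝ) : ℂ) • g = f := hg
  apply hf
  rw [← hPg, map_sub, hℓ, map_smul, smul_eq_mul, sub_self]

end IsStabilisation

end Chain

theorem mainTheorem1 {V : Type*} [Fintype V] [DecidableEq V]
    (K : Matrix V V ℝ) (hK : IsSubstochastic K) (hK' : IsNondegenerate K)
    (lam : ℝ) (hlam : 0 < lam)
    (ν : V → ℝ) (hν : ∀ x, 0 ≤ ν x) (hν1 : ∑ x, ν x = 1)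
    (hreach : ∀ x, ∃ y, 0 < ν y ∧ Relation.ReflTransGen (fun a b => 0 < K a b) y x) :
    IsRelaxationTime (arwMatrix K lam ν) (⨅ x, visitProb K ν x)⁻¹ := by
  choose h hh using exists_isSiteHarmonic hK hK' hlam.le
  have hstab : IsStabilisation K lam h := hh
  have hne : Nonempty V := by
    by_contra hV
    rw [not_nonempty_iff] at hV
    simp at hν1
  have hpos : ∀ w, 0 < visitProb K ν w := fun w => by
    obtain ⟨v, hv⟩ := exists_isVisitFunction hK hK' w
    obtain ⟨y, hy, hyw⟩ := hreach w
    rw [visitProb_eq hK hK' ν hv]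
    exact Finset.sum_pos' (fun x _ => mul_nonneg (hν x) (hv.nonneg hK hK' x))
      ⟨y, Finset.mem_univ y, mul_pos hy (hv.pos hK hK' hyw)⟩
  have hle : ∀ w, visitProb K ν w ≤ 1 := fun w => by
    obtain ⟨v, hv⟩ := exists_isVisitFunction hK hK' w
    rw [visitProb_eq hK hK' ν hv, ← hν1]
    exact Finset.sum_le_sum fun x _ => mul_le_of_le_one_right (hν x) (hv.le_one hK hK' x)
  obtain ⟨w, hw⟩ := exists_eq_ciInf_of_finite (f := visitProb K ν)
  rw [← hw]
  refine ⟨1 - visitProb K ν w, ⟨⟨((1 - visitProb K ν w : ℝ) : ℂ), ?_,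
    hstab.hasEigenvalue_one_sub hK hK' hlam hν1 w, ?_⟩, ?_⟩, by linarith [hpos w], by simp⟩
  · rw [Ne, Complex.ofReal_eq_one]
    linarith [hpos w]
  · rw [Complex.norm_real, Real.norm_of_nonneg (by linarith [hle w])]
  · rintro _ ⟨z, hz1, hz, rfl⟩
    obtain ⟨w', hw'⟩ := hstab.norm_eigenvalue_le hK hK' hlam.le hν hν1 hz hz1
    have : visitProb K ν w ≤ visitProb K ν w' :=
      hw.trans_le (ciInf_le (Set.finite_range _).bddBelow w')
    linarith
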